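/- Let $n$ be a degree and $p$ a prime. Let $\mathfrak b$ be a fractional ideal and $\mathfrak c$ an integral ideal of $\mathbb Q$ (both non-zero) with $\mathfrak b^{-1}\subseteq 2\mathbb Z$, $\mathfrak{bc}\subseteq 2\mathbb Z$ and $p\nmid\mathfrak c$. Put $\tilde r=(r^T)^{-1}$. **Groups.** Let $P_p$ be the group of matrices $\begin{pmatrix} a&b\\0&d\end{pmatrix}$ in $Sp_n(\mathbb Q_p)$ ($2n\times 2n$ matrices), and let $(D_0)_p=P_p\cap D_p[\mathfrak b^{-1},\mathfrak{bc}]$ be its subgroup of elements with $a,d\in M_n(\mathbb Z_p)$, $b\in M_n(\mathfrak b^{-1}_p)$. Let $r_P(g)$ be the operator $(r_P(g)f)(x)=|\det a|_p^{1/2}\,e_p(\tfrac12\, x a b^{T}x^{T})\,f(xa)$ on functions on $\mathbb Q_p^n$, where $e_p(x)=e^{-2\pi i\{x\}}$; the preimage of $P_p$ in the metaplectic group is $\{\zeta\, r_P(g) : \zeta\in\mathbb T,\ g\in P_p\}\cong P_p\times\mathbb T$. Let $J(\zeta\, r_P(g))=\zeta^{-1}J(r_P(g))$, where $J(r_P(g))$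 is the inverse of the phase of $\int_{\mathbb Z_p^n}(r_P(g)\mathbf 1_{\mathbb Z_p^n})(x)\,dx$ (a normalised Gauss sum). **Hecke rings.** Let $W_0$ be the group of pairs $(\alpha,t)$ with $\alpha$ in the preimage of $P_p$ and $t\in\mathbb T$, with multiplication $(\alpha,t)(\beta,u)=\bigl(\alpha\beta,\ tu\,J(\alpha)J(\beta)J(\alpha\beta)^{-1}\bigr)$, and let $V_0=\{(\alpha,1) : \alpha \text{ lies over } (D_0)_p\}$. Let $\mathcal R(V_0,W_0)$ be the Hecke ring of finite complex linear combinations of double cosets $V_0\xi V_0$, each identified with the formal sum of the right cosets $V_0\xi_i$ it contains, with product induced by $V_0\xi\cdot V_0\eta=V_0\xi\eta$. Let $\mathcal S_{0p}$ be the quotient of $\mathcal R(V_0,W_0)$ by the two-sided ideal generated by all $V_0(\alpha,1)V_0-t\,V_0(\alpha,t)V_0$. For $r\in GL_n(\mathbb Q_p)$ let $A_r\in\mathcal S_{0p}$ be the image of $V_0(r_P(\operatorname{diag}[\tilde r,r]),1)V_0$ (that is, the double coset $(D_0)_p\operatorname{diag}[\tilde r,r](D_0)_p$), and let $U_p=A_{pI_n}$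 be the double coset of $\operatorname{diag}[p^{-1}I_n,pI_n]$. Let $$\mathcal C=\{A\in\mathcal S_{0p} : U_pA=AU_p\}.$$ **The map.** Let $\Phi_p':\mathcal S_{0p}\to\mathcal R(GL_n(\mathbb Z_p),GL_n(\mathbb Q_p))$ be the $\mathbb C$-linear map given on right cosets by $V_0(r_P(\alpha),t)\mapsto t^{-1}J(r_P(\alpha))^{-1}\,GL_n(\mathbb Z_p)\,d$ for $\alpha=\begin{pmatrix} a&b\\0&d\end{pmatrix}\in P_p$. **Theorem.** 1. Every $A\in\mathcal C$ is a linear combination of double cosets $A_r$ with $r\in M_n(\mathbb Z_p)\cap GL_n(\mathbb Q_p)$. 2. The restriction of $\Phi_p'$ to $\mathcal C$ is injective. (Both statements pass to any subspace of $\mathcal S_{0p}$ in place of $\mathcal S_{0p}$, for instance the linear span of the $A_r$ or the subring generated by them.) -/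

import Mathlib

open Matrix

/-! ### Abstract Hecke rings

For a subgroup `K` of a group `G`, the Hecke ring is realised on the finite formal sums of right
cosets `K g` that are invariant under right multiplication by `K`.  When double cosets are finite
unions of right cosets, these are the finite formal sums of double cosets `K g K = ∑ K gᵢ`. -/

namespace HeckeAlg

variable {G : Type*} [Group G] (K : Subgroup G)

/-- The set `K \ G` of right cosets `K g`. -/
abbrev RCoset : Type _ := Quotient (QuotientGroup.rightRel K)

/-- The right coset `K g`. -/
def rmk (g : G) : RCoset K := Quotient.mk (QuotientGroup.rightRel K) g

theorem rmk_eq {x y : G} : rmk K x = rmk K y ↔ y * x⁻¹ ∈ K := by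
  unfold rmk
  rw [Quotient.eq, QuotientGroup.rightRel_apply]

theorem rmk_out (y : RCoset K) : rmk K y.out = y := Quotient.out_eq y

/-- Right multiplication `K x ↦ K x g`. -/
def rmulCoset (g : G) : RCoset K → RCoset K :=
  Quotient.lift (fun x => rmk K (x * g)) (by
    intro x y h
    rw [rmk_eq]
    have h' : y * x⁻¹ ∈ K := QuotientGroup.rightRel_apply.1 h
    simpa [mul_assoc] using h')

@[simp] theorem rmulCoset_rmk (g x : G) : rmulCoset K g (rmk K x) = rmk K (x * g) := rfl

theorem rmulCoset_mul (g h : G) (y : RCoset K) :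
    rmulCoset K (g * h) y = rmulCoset K h (rmulCoset K g y) := by
  rw [← rmk_out K y]; simp [mul_assoc]

theorem rmulCoset_one (y : RCoset K) : rmulCoset K 1 y = y := by
  rw [← rmk_out K y, rmulCoset_rmk, mul_one]

/-- Right multiplication by `g` on formal sums of right cosets. -/
noncomputable def transl (g : G) : (RCoset K →₀ ℂ) →ₗ[ℂ] (RCoset K →₀ ℂ) :=
  Finsupp.lmapDomain ℂ ℂ (rmulCoset K g)

@[simp] theorem transl_single (g : G) (y : RCoset K) (c : ℂ) :
    transl K g (Finsupp.single y c) = Finsupp.single (rmulCoset K g y) c := by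
  simp [transl]

theorem transl_mul (g h : G) (A : RCoset K →₀ ℂ) :
    transl K (g * h) A = transl K h (transl K g A) := by
  induction A using Finsupp.induction_linear with
  | zero => simp
  | add f g hf hg => simp [hf, hg]
  | single a b => simp [rmulCoset_mul]

theorem transl_one (A : RCoset K →₀ ℂ) : transl K 1 A = A := by
  induction A using Finsupp.induction_linear with
  | zero => simp
  | add f g hf hg => simp [hf, hg]
  | single a b => simp [rmulCoset_one]

/-- The formal sums of right cosets invariant under right multiplication by `K`. -/
noncomputable def invariants : Submodule ℂ (RCoset K →₀ ℂ) where
  carrier := {A | ∀ k ∈ K, transl K k A = A}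
  add_mem' := by
    intro A B hA hB k hk
    rw [map_add, hA k hk, hB k hk]
  zero_mem' := by intro k _; simp
  smul_mem' := by
    intro c A hA k hk
    rw [map_smul, hA k hk]

/-- The product `(∑ aᵢ K αᵢ) * (∑ bⱼ K βⱼ) = ∑ aᵢ bⱼ K αᵢ βⱼ` of formal sums of right cosets, as a
linear map in the second factor.  It does not depend on the representatives `βⱼ` when the first
factor is invariant. -/
noncomputable def convolve (A : RCoset K →₀ ℂ) : (RCoset K →₀ ℂ) →ₗ[ℂ] (RCoset K →₀ ℂ) :=
  Finsupp.linearCombination ℂ (fun y : RCoset K => transl K y.out A)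

theorem convolve_single {A : RCoset K →₀ ℂ} (hA : A ∈ invariants K) (g : G) (c : ℂ) :
    convolve K A (Finsupp.single (rmk K g) c) = c • transl K g A := by
  unfold convolve
  rw [Finsupp.linearCombination_single]
  congr 1
  have h : g * (rmk K g).out⁻¹ ∈ K := (rmk_eq K).1 (rmk_out K (rmk K g))
  have h2 : transl K (g * (rmk K g).out⁻¹ * (rmk K g).out) A = transl K (rmk K g).out A := by
    rw [transl_mul, hA _ h]
  rw [← h2]; simp

theorem convolve_transl {A : RCoset K →₀ ℂ} (hA : A ∈ invariants K) (g : G) (B : RCoset K →₀ ℂ) :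
    convolve K A (transl K g B) = transl K g (convolve K A B) := by
  induction B using Finsupp.induction_linear with
  | zero => simp
  | add f g hf hg => simp [hf, hg]
  | single y c =>
    rw [← rmk_out K y, transl_single, rmulCoset_rmk, convolve_single K hA, convolve_single K hA,
      map_smul, transl_mul]

theorem convolve_mem {A B : RCoset K →₀ ℂ} (hA : A ∈ invariants K) (hB : B ∈ invariants K) :
    convolve K A B ∈ invariants K := by
  intro k hk
  rw [← convolve_transl K hA, hB k hk]

theorem convolve_assoc {A B : RCoset K →₀ ℂ} (hA : A ∈ invariants K) (hB : B ∈ invariants K)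
    (C : RCoset K →₀ ℂ) :
    convolve K (convolve K A B) C = convolve K A (convolve K B C) := by
  induction C using Finsupp.induction_linear with
  | zero => simp
  | add f g hf hg => simp [hf, hg]
  | single y c =>
    rw [← rmk_out K y, convolve_single K (convolve_mem K hA hB), convolve_single K hB, map_smul,
      convolve_transl K hA]

theorem one_mem_invariants : Finsupp.single (rmk K 1) 1 ∈ invariants K := by
  intro k hk
  rw [transl_single, rmulCoset_rmk, one_mul]
  congr 1
  rw [rmk_eq]
  simpa using K.inv_mem hk

theorem convolve_one {A : RCoset K →₀ ℂ} (hA : A ∈ invariants K) :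
    convolve K A (Finsupp.single (rmk K 1) 1) = A := by
  rw [convolve_single K hA, one_smul, transl_one]

theorem one_convolve (B : RCoset K →₀ ℂ) :
    convolve K (Finsupp.single (rmk K 1) 1) B = B := by
  induction B using Finsupp.induction_linear with
  | zero => simp
  | add f g hf hg => simp [hf, hg]
  | single y c =>
    rw [← rmk_out K y, convolve_single K (one_mem_invariants K), transl_single, rmulCoset_rmk]
    simp

theorem convolve_add (A A' B : RCoset K →₀ ℂ) :
    convolve K (A + A') B = convolve K A B + convolve K A' B := by
  simp [convolve, Finsupp.linearCombination_apply, Finsupp.sum_add]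

theorem convolve_smul (c : ℂ) (A B : RCoset K →₀ ℂ) :
    convolve K (c • A) B = c • convolve K A B := by
  simp only [convolve, Finsupp.linearCombination_apply, map_smul, Finsupp.smul_sum]
  exact Finsupp.sum_congr fun _ _ => smul_comm _ _ _

end HeckeAlg

open HeckeAlg in
/-- The Hecke ring of the pair `(K, G)` with complex coefficients. -/
def HeckeAlgebra {G : Type*} [Group G] (K : Subgroup G) : Type _ := invariants K

namespace HeckeAlg

section ringStructure

variable {G : Type*} [Group G] (K : Subgroup G)

noncomputable instance : AddCommGroup (HeckeAlgebra K) :=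
  inferInstanceAs (AddCommGroup (invariants K))

noncomputable instance : Module ℂ (HeckeAlgebra K) :=
  inferInstanceAs (Module ℂ (invariants K))

/-- The underlying formal sum of right cosets. -/
noncomputable def toSum : HeckeAlgebra K →ₗ[ℂ] (RCoset K →₀ ℂ) := (invariants K).subtype

theorem toSum_mem (A : HeckeAlgebra K) : toSum K A ∈ invariants K := A.2

theorem toSum_injective : Function.Injective (toSum K) := Subtype.val_injective

/-- An invariant formal sum of right cosets as an element of the Hecke ring. -/
noncomputable def ofSum (A : RCoset K →₀ ℂ) (hA : A ∈ invariants K) : HeckeAlgebra K := ⟨A, hA⟩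

@[simp] theorem toSum_ofSum (A : RCoset K →₀ ℂ) (hA : A ∈ invariants K) :
    toSum K (ofSum K A hA) = A := rfl

noncomputable instance : Mul (HeckeAlgebra K) :=
  ⟨fun A B => ofSum K (convolve K (toSum K A) (toSum K B))
    (convolve_mem K (toSum_mem K A) (toSum_mem K B))⟩

noncomputable instance : One (HeckeAlgebra K) :=
  ⟨ofSum K (Finsupp.single (rmk K 1) 1) (one_mem_invariants K)⟩

theorem toSum_mul (A B : HeckeAlgebra K) :
    toSum K (A * B) = convolve K (toSum K A) (toSum K B) := rfl

theorem toSum_one : toSum K (1 : HeckeAlgebra K) = Finsupp.single (rmk K 1) 1 := rfl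

noncomputable instance : Ring (HeckeAlgebra K) :=
  { (inferInstance : AddCommGroup (HeckeAlgebra K)) with
    mul := (· * ·)
    one := 1
    mul_assoc := fun A B C => toSum_injective K (by
      simp only [toSum_mul]
      exact convolve_assoc K (toSum_mem K A) (toSum_mem K B) _)
    one_mul := fun A => toSum_injective K (by
      simp only [toSum_mul, toSum_one]; exact one_convolve K _)
    mul_one := fun A => toSum_injective K (by
      simp only [toSum_mul, toSum_one]; exact convolve_one K (toSum_mem K A))
    left_distrib := fun A B C => toSum_injective K (by simp only [toSum_mul, map_add])
    right_distrib := fun A B C => toSum_injective K (by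
      simp only [toSum_mul, map_add, convolve_add])
    zero_mul := fun A => toSum_injective K (by
      simp only [toSum_mul, map_zero]
      simpa using convolve_smul K 0 0 (toSum K A))
    mul_zero := fun A => toSum_injective K (by simp only [toSum_mul, map_zero]) }

noncomputable instance : Algebra ℂ (HeckeAlgebra K) :=
  Algebra.ofModule
    (fun c A B => toSum_injective K (by simp only [toSum_mul, map_smul, convolve_smul]))
    (fun c A B => toSum_injective K (by simp only [toSum_mul, map_smul]))

/-- The right cosets contained in the double coset `K g K`. -/
def cosetsIn (g : G) : Set (RCoset K) := {y | ∃ k ∈ K, y = rmk K (g * k)}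

/-- The Hecke pair condition: every double coset is a finite union of right cosets. -/
def IsHeckePair : Prop := ∀ g : G, (cosetsIn K g).Finite

variable {K}

/-- The double coset `K g K`, that is the sum of the right cosets it contains. -/
noncomputable def dcoset (hK : IsHeckePair K) (g : G) : HeckeAlgebra K :=
  ofSum K (∑ y ∈ (hK g).toFinset, Finsupp.single y 1) (by
    intro k hk
    rw [map_sum]
    simp only [transl_single]
    refine Finset.sum_bij' (fun y _ => rmulCoset K k y) (fun y _ => rmulCoset K k⁻¹ y)
      ?_ ?_ ?_ ?_ ?_
    · intro y hy
      obtain ⟨l, hl, rfl⟩ := (hK g).mem_toFinset.1 hy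
      exact (hK g).mem_toFinset.2 ⟨l * k, K.mul_mem hl hk, by simp [mul_assoc]⟩
    · intro y hy
      obtain ⟨l, hl, rfl⟩ := (hK g).mem_toFinset.1 hy
      exact (hK g).mem_toFinset.2 ⟨l * k⁻¹, K.mul_mem hl (K.inv_mem hk), by simp [mul_assoc]⟩
    · intro y _
      rw [← rmulCoset_mul, mul_inv_cancel, rmulCoset_one]
    · intro y _
      rw [← rmulCoset_mul, inv_mul_cancel, rmulCoset_one]
    · intro y _
      rfl)

theorem toSum_dcoset_mul_central (hK : IsHeckePair K) {z : G} (hz : ∀ w, z * w = w * z) (g : G) :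
    toSum K (dcoset hK (g * z)) = transl K z (toSum K (dcoset hK g)) := by
  have hinv : ∀ w, z⁻¹ * w = w * z⁻¹ := fun w => by
    rw [inv_mul_eq_iff_eq_mul, ← mul_assoc, hz, mul_assoc, mul_inv_cancel, mul_one]
  change ∑ y ∈ (hK (g * z)).toFinset, Finsupp.single y (1 : ℂ)
    = transl K z (∑ y ∈ (hK g).toFinset, Finsupp.single y (1 : ℂ))
  rw [map_sum]
  simp only [transl_single]
  refine (Finset.sum_bij' (fun y _ => rmulCoset K z y) (fun y _ => rmulCoset K z⁻¹ y)
    ?_ ?_ ?_ ?_ ?_).symm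
  · intro y hy
    obtain ⟨l, hl, rfl⟩ := (hK g).mem_toFinset.1 hy
    exact (hK (g * z)).mem_toFinset.2 ⟨l, hl, by simp [mul_assoc, hz]⟩
  · intro y hy
    obtain ⟨l, hl, rfl⟩ := (hK (g * z)).mem_toFinset.1 hy
    exact (hK g).mem_toFinset.2 ⟨l, hl, by
      rw [rmulCoset_rmk, mul_assoc, ← hinv]
      group⟩
  · intro y _
    rw [← rmulCoset_mul, mul_inv_cancel, rmulCoset_one]
  · intro y _
    rw [← rmulCoset_mul, inv_mul_cancel, rmulCoset_one]
  · intro y _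
    rfl

end ringStructure

section push

variable {G H : Type*} [Group G] [Group H] (K : Subgroup G) (L : Subgroup H)
  (f : G →* H) (χ : G →* Circle) (hf : ∀ k ∈ K, f k ∈ L) (hχ : ∀ k ∈ K, χ k = 1)

/-- The linear map `K g ↦ χ(g) L f(g)` on formal sums of right cosets. -/
noncomputable def pushSum : (RCoset K →₀ ℂ) →ₗ[ℂ] (RCoset L →₀ ℂ) :=
  Finsupp.linearCombination ℂ (Quotient.lift
    (fun g => Finsupp.single (rmk L (f g)) (χ g : ℂ)) (by
      intro x y h
      have h' : y * x⁻¹ ∈ K := QuotientGroup.rightRel_apply.1 h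
      have h1 : rmk L (f x) = rmk L (f y) := by
        rw [rmk_eq]; simpa using hf _ h'
      have h2 : χ x = χ y := by
        have := hχ _ h'
        rw [map_mul, map_inv, mul_inv_eq_one] at this
        exact this.symm
      simp only [h1, h2]))

theorem pushSum_single (g : G) (c : ℂ) :
    pushSum K L f χ hf hχ (Finsupp.single (rmk K g) c)
      = c • Finsupp.single (rmk L (f g)) (χ g : ℂ) := by
  unfold pushSum
  rw [Finsupp.linearCombination_single]
  rfl

theorem pushSum_transl (g : G) (A : RCoset K →₀ ℂ) :
    pushSum K L f χ hf hχ (transl K g A)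
      = (χ g : ℂ) • transl L (f g) (pushSum K L f χ hf hχ A) := by
  induction A using Finsupp.induction_linear with
  | zero => simp
  | add f g hf hg => simp [hf, hg]
  | single y c =>
    rw [← rmk_out K y, transl_single, rmulCoset_rmk, pushSum_single, pushSum_single]
    simp only [map_mul, transl_single, rmulCoset_rmk, Finsupp.smul_single, smul_eq_mul,
      Circle.coe_mul]
    congr 1
    ring

theorem pushSum_convolve_single {A : RCoset K →₀ ℂ} (hA : A ∈ invariants K)
    (hA' : pushSum K L f χ hf hχ A ∈ invariants L) (B : RCoset K →₀ ℂ) :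
    pushSum K L f χ hf hχ (convolve K A B)
      = convolve L (pushSum K L f χ hf hχ A) (pushSum K L f χ hf hχ B) := by
  induction B using Finsupp.induction_linear with
  | zero => simp
  | add f g hf hg => simp [hf, hg]
  | single y c =>
    rw [← rmk_out K y, convolve_single K hA, pushSum_single, map_smul, map_smul,
      convolve_single L hA', pushSum_transl]

/-- The algebra homomorphism `K g ↦ χ(g) L f(g)` of Hecke rings, for a homomorphism `f` that maps
`K` onto `L` and a character `χ` that is trivial on `K`. -/
noncomputable def push (hL : ∀ l ∈ L, ∃ k ∈ K, f k = l) : HeckeAlgebra K →ₐ[ℂ] HeckeAlgebra L :=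
  have hinv : ∀ A : HeckeAlgebra K, pushSum K L f χ hf hχ (toSum K A) ∈ invariants L := by
    intro A l hl
    obtain ⟨k, hk, rfl⟩ := hL l hl
    have h := pushSum_transl K L f χ hf hχ k (toSum K A)
    rw [toSum_mem K A k hk, hχ k hk] at h
    simpa using h.symm
  AlgHom.ofLinearMap
    { toFun := fun A => ofSum L (pushSum K L f χ hf hχ (toSum K A)) (hinv A)
      map_add' := fun A B => toSum_injective L (by simp)
      map_smul' := fun c A => toSum_injective L (by simp) }
    (toSum_injective L (by
      simp [toSum_one, pushSum_single]))
    (fun A B => toSum_injective L (by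
      simp only [LinearMap.coe_mk, AddHom.coe_mk, toSum_ofSum, toSum_mul]
      exact pushSum_convolve_single K L f χ hf hχ (toSum_mem K A) (hinv A) _))

theorem toSum_push (hL : ∀ l ∈ L, ∃ k ∈ K, f k = l) (A : HeckeAlgebra K) :
    toSum L (push K L f χ hf hχ hL A) = pushSum K L f χ hf hχ (toSum K A) := rfl

end push

end HeckeAlg

/-! ### The Siegel parabolic subgroup over `ℚ_p` -/

namespace Metaplectic

section parabolic

variable (n p : ℕ) [Fact p.Prime]

/-- `Sp_n(ℚ_p)`, consisting of `2n × 2n` matrices. -/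
abbrev Sp : Type := symplecticGroup (Fin n) ℚ_[p]

/-- The Siegel parabolic `P_p = {α ∈ Sp_n(ℚ_p) | c_α = 0}`. -/
def siegelParabolic : Subgroup (Sp n p) where
  carrier := {g | g.1.toBlocks₂₁ = 0}
  one_mem' := by
    ext i j
    simp [toBlocks₂₁]
  mul_mem' := by
    intro g h hg hh
    ext i j
    have hg' : ∀ i j, g.1 (Sum.inr i) (Sum.inl j) = 0 := fun i j => congrFun (congrFun hg i) j
    have hh' : ∀ i j, h.1 (Sum.inr i) (Sum.inl j) = 0 := fun i j => congrFun (congrFun hh i) j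
    simp [toBlocks₂₁, Matrix.mul_apply, hg', hh']
  inv_mem' := by
    intro g hg
    ext i j
    have hg' : ∀ i j, g.1 (Sum.inr i) (Sum.inl j) = 0 := fun i j => congrFun (congrFun hg i) j
    have h : (g⁻¹ : Sp n p).1 = (-Matrix.J (Fin n) ℚ_[p]) * g.1ᵀ * Matrix.J (Fin n) ℚ_[p] :=
      SymplecticGroup.coe_inv g
    change (g⁻¹ : Sp n p).1 (Sum.inr i) (Sum.inl j) = 0
    rw [h]
    simp [Matrix.mul_apply, Matrix.J, Matrix.one_apply, Matrix.fromBlocks, hg']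

abbrev Parab : Type := siegelParabolic n p

end parabolic

variable {n p : ℕ} [Fact p.Prime]

/-- The blocks of `α = (a b; 0 d)`. -/
def blockA (g : Parab n p) : Matrix (Fin n) (Fin n) ℚ_[p] := g.1.1.toBlocks₁₁
def blockB (g : Parab n p) : Matrix (Fin n) (Fin n) ℚ_[p] := g.1.1.toBlocks₁₂
def blockD (g : Parab n p) : Matrix (Fin n) (Fin n) ℚ_[p] := g.1.1.toBlocks₂₂

theorem coe_eq (g : Parab n p) : g.1.1 = fromBlocks (blockA g) (blockB g) 0 (blockD g) := by
  have h : g.1.1.toBlocks₂₁ = 0 := g.2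
  conv_lhs => rw [← fromBlocks_toBlocks g.1.1, h]
  rfl

theorem mul_eq (g h : Parab n p) : (g * h).1.1 = fromBlocks (blockA g * blockA h)
    (blockA g * blockB h + blockB g * blockD h) 0 (blockD g * blockD h) := by
  change g.1.1 * h.1.1 = _
  rw [coe_eq g, coe_eq h, fromBlocks_multiply]
  simp

theorem blockA_mul (g h : Parab n p) : blockA (g * h) = blockA g * blockA h := by
  unfold blockA; rw [mul_eq]; simp [blockA]

theorem blockB_mul (g h : Parab n p) :
    blockB (g * h) = blockA g * blockB h + blockB g * blockD h := by
  rw [blockB, mul_eq]; simp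

theorem blockD_mul (g h : Parab n p) : blockD (g * h) = blockD g * blockD h := by
  rw [blockD, mul_eq]; simp

theorem inv_eq (g : Parab n p) :
    (g⁻¹).1.1 = fromBlocks (blockD g)ᵀ (-(blockB g)ᵀ) 0 (blockA g)ᵀ := by
  change (g.1⁻¹).1 = _
  have h : (g.1⁻¹).1 = (-Matrix.J (Fin n) ℚ_[p]) * g.1.1ᵀ * Matrix.J (Fin n) ℚ_[p] :=
    SymplecticGroup.coe_inv g.1
  rw [h, coe_eq g, Matrix.J, fromBlocks_transpose, fromBlocks_neg, fromBlocks_multiply,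
    fromBlocks_multiply]
  simp

theorem blockA_inv (g : Parab n p) : blockA g⁻¹ = (blockD g)ᵀ := by
  rw [blockA, inv_eq]; simp

theorem blockB_inv (g : Parab n p) : blockB g⁻¹ = -(blockB g)ᵀ := by
  rw [blockB, inv_eq]; simp

theorem blockD_inv (g : Parab n p) : blockD g⁻¹ = (blockA g)ᵀ := by
  rw [blockD, inv_eq]; simp

theorem blockD_one : blockD (1 : Parab n p) = 1 := by
  ext i j
  simp [blockD, toBlocks₂₂, Matrix.one_apply]

/-- The homomorphism `(a b; 0 d) ↦ d` to `GL_n(ℚ_p)`. -/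
noncomputable def dHom : Parab n p →* GL (Fin n) ℚ_[p] :=
  MonoidHom.toHomUnits
    { toFun := blockD
      map_one' := blockD_one
      map_mul' := blockD_mul }

theorem dHom_coe (g : Parab n p) : (dHom g).1 = blockD g := rfl

/-- `diag[r̃, r]`, where `r̃ = (rᵀ)⁻¹`. -/
noncomputable def diagP (r : GL (Fin n) ℚ_[p]) : Parab n p :=
  ⟨⟨fromBlocks ((r⁻¹).1ᵀ) 0 0 r.1, by
    rw [SymplecticGroup.mem_iff, Matrix.J, fromBlocks_transpose, fromBlocks_multiply,
      fromBlocks_multiply]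
    have h1 : (r⁻¹).1ᵀ * r.1ᵀ = 1 := by
      rw [← transpose_mul, Units.mul_inv, transpose_one]
    have h2 : r.1 * (r⁻¹).1 = 1 := Units.mul_inv r
    simp only [transpose_transpose, transpose_zero, Matrix.mul_zero, Matrix.zero_mul, add_zero,
      zero_add, Matrix.mul_neg, Matrix.neg_mul, Matrix.mul_one, neg_zero, h1, h2]⟩,
    by
      change (fromBlocks _ _ _ _ : Matrix _ _ ℚ_[p]).toBlocks₂₁ = 0
      simp⟩

theorem blockA_diagP (r : GL (Fin n) ℚ_[p]) : blockA (diagP r) = (r⁻¹).1ᵀ := rfl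
theorem blockB_diagP (r : GL (Fin n) ℚ_[p]) : blockB (diagP r) = 0 := rfl
theorem blockD_diagP (r : GL (Fin n) ℚ_[p]) : blockD (diagP r) = r.1 := rfl

/-! ### Weil representation of the parabolic and the constant `J` -/

theorem padic_scaled_norm (x : ℚ_[p]) :
    ‖x * (p : ℚ_[p]) ^ (-x.valuation).toNat‖ ≤ 1 := by
  have hp1 : (1 : ℝ) ≤ p := by exact_mod_cast (Fact.out : p.Prime).one_lt.le
  have hp0 : (0 : ℝ) < p := by linarith
  by_cases hx : x = 0
  · simp [hx]
  rw [norm_mul, norm_pow, Padic.norm_p, Padic.norm_eq_zpow_neg_valuation hx, inv_pow,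
    ← div_eq_mul_inv, div_le_one (pow_pos hp0 _), ← zpow_natCast]
  exact zpow_le_zpow_right₀ hp1 (Int.self_le_toNat _)

/-- The fractional part of `x ∈ ℚ_p`: the rational `m / p ^ k` with `0 ≤ m < p ^ k` that is
congruent to `x` modulo `ℤ_p`. -/
noncomputable def padicFract (x : ℚ_[p]) : ℚ :=
  ((PadicInt.appr ⟨x * (p : ℚ_[p]) ^ (-x.valuation).toNat, padic_scaled_norm x⟩
    (-x.valuation).toNat : ℕ) : ℚ) / (p : ℚ) ^ (-x.valuation).toNat

/-- The additive character `e_p(x) = exp(-2πi{x})`. -/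
noncomputable def ePadic (x : ℚ_[p]) : Circle := Circle.exp (-(2 * Real.pi * (padicFract x : ℝ)))

theorem ePadic_of_integral {x : ℚ_[p]} (hx : ‖x‖ ≤ 1) : ePadic x = 1 := by
  have hv : (-x.valuation).toNat = 0 := by
    by_cases h0 : x = 0
    · simp [h0]
    · rw [Int.toNat_eq_zero]
      have := (Padic.norm_le_one_iff_val_nonneg x).1 hx
      omega
  have : padicFract x = 0 := by
    unfold padicFract
    simp [hv, PadicInt.appr]
  simp [ePadic, this]

/-- The operator `r_P(α)` for `α = (a b; 0 d)`, acting on functions on `ℚ_p^n` (row vectors) by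
`f ↦ |det a|^{1/2} e_p(½ x a bᵀ xᵀ) f(x a)`. -/
noncomputable def weilOp (g : Parab n p) (f : (Fin n → ℚ_[p]) → ℂ) (x : Fin n → ℚ_[p]) : ℂ :=
  ((‖(blockA g).det‖ ^ (1 / 2 : ℝ) : ℝ) : ℂ) *
    (ePadic (x ⬝ᵥ ((blockA g * (blockB g)ᵀ) *ᵥ x) / 2) : ℂ) * f (x ᵥ* blockA g)

open Classical in
/-- The characteristic function of `ℤ_p^n`. -/
noncomputable def latticeFn (x : Fin n → ℚ_[p]) : ℂ := if ∀ i, ‖x i‖ ≤ 1 then 1 else 0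

/-- The matrix coefficient `⟨r_P(α) φ, φ⟩ = ∫_{ℤ_p^n} (r_P(α) φ)(x) dx` where `φ` is the
characteristic function of `ℤ_p^n` and the Haar measure has total mass one. -/
noncomputable def latticeCoeff (g : Parab n p) : ℂ :=
  letI : MeasurableSpace (Fin n → ℤ_[p]) := borel _
  haveI : BorelSpace (Fin n → ℤ_[p]) := ⟨rfl⟩
  ∫ x : Fin n → ℤ_[p], weilOp g latticeFn (fun i => (x i : ℚ_[p]))
    ∂(MeasureTheory.Measure.addHaarMeasure ⊤)

/-- The preimage of `P_p` in the metaplectic group `M_p`, that is `P_p × 𝕋` by means of the lift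
`r_P`: the pair `(g, ζ)` is `ζ r_P(g)`. -/
abbrev MetaParab (n p : ℕ) [Fact p.Prime] : Type := Parab n p × Circle

/-- The value of `J` on `r_P(g)`: the inverse of the phase of the coefficient
`⟨r_P(g) φ, φ⟩`, a normalised Gauss sum.  For `p` odd, `φ` spans the line fixed by the elements
lying over `Sp_n(ℤ_p)`, so this is the function on the metaplectic group that is multiplicative for
these elements on both sides and is `1` on all `r_P(diag[r̃, r])`. -/
noncomputable def phaseJ (g : Parab n p) : Circle := Circle.exp (-(latticeCoeff g).arg)

/-- The constant `J`, extended from `r_P(P_p)` by `J(ζ σ) = ζ⁻¹ J(σ)`. -/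
noncomputable def constJ (α : MetaParab n p) : Circle := α.2⁻¹ * phaseJ α.1

theorem phaseJ_eq_one (g : Parab n p)
    (h : ∀ x : Fin n → ℚ_[p], (∀ i, ‖x i‖ ≤ 1) →
      ‖x ⬝ᵥ ((blockA g * (blockB g)ᵀ) *ᵥ x) / 2‖ ≤ 1) : phaseJ g = 1 := by
  obtain ⟨w, hw0, hw⟩ : ∃ w : (Fin n → ℤ_[p]) → ℝ, (∀ x, 0 ≤ w x) ∧
      ∀ x : Fin n → ℤ_[p], weilOp g latticeFn (fun i => (x i : ℚ_[p])) = (w x : ℂ) := by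
    refine ⟨fun x => ‖(blockA g).det‖ ^ (1 / 2 : ℝ) *
        (if ∀ i, ‖((fun i => (x i : ℚ_[p])) ᵥ* blockA g) i‖ ≤ 1 then 1 else 0), ?_, ?_⟩
    · intro x
      dsimp only
      split_ifs <;> positivity
    · intro x
      unfold weilOp latticeFn
      rw [ePadic_of_integral (h _ fun i => PadicInt.norm_le_one (x i))]
      by_cases hc : ∀ i, ‖((fun i => (x i : ℚ_[p])) ᵥ* blockA g) i‖ ≤ 1
      · rw [if_pos hc]
        simp only
        rw [if_pos hc]
        simp
      · rw [if_neg hc]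
        simp only
        rw [if_neg hc]
        simp
  let _ : MeasurableSpace (Fin n → ℤ_[p]) := borel _
  have _ : BorelSpace (Fin n → ℤ_[p]) := ⟨rfl⟩
  have h2 : latticeCoeff g =
      ((∫ x, w x ∂(MeasureTheory.Measure.addHaarMeasure ⊤) : ℝ) : ℂ) := by
    unfold latticeCoeff
    simp only [hw]
    exact integral_ofReal
  rw [phaseJ, h2, Complex.arg_ofReal_of_nonneg (MeasureTheory.integral_nonneg hw0)]
  simp

theorem phaseJ_one : phaseJ (1 : Parab n p) = 1 := by
  apply phaseJ_eq_one
  intro x _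
  have : blockB (1 : Parab n p) = 0 := by
    ext i j
    simp [blockB, toBlocks₁₂]
  simp [this]

/-! ### The metaplectic Hecke pair -/

/-- The group of pairs `(α, t)` with `α ∈ pr⁻¹(P_p)`, `t ∈ 𝕋`, with the law of multiplication
`(α, t)(β, u) = (α β, t u J(α) J(β) / J(α β))`. -/
@[ext] structure MetaPair (n p : ℕ) [Fact p.Prime] where
  α : MetaParab n p
  t : Circle

namespace MetaPair

noncomputable instance : Mul (MetaPair n p) :=
  ⟨fun x y => ⟨x.α * y.α, x.t * y.t * (constJ x.α * constJ y.α / constJ (x.α * y.α))⟩⟩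

noncomputable instance : One (MetaPair n p) := ⟨⟨1, 1⟩⟩

noncomputable instance : Inv (MetaPair n p) :=
  ⟨fun x => ⟨x.α⁻¹, x.t⁻¹ * (constJ x.α * constJ x.α⁻¹)⁻¹⟩⟩

theorem mul_def (x y : MetaPair n p) :
    x * y = ⟨x.α * y.α, x.t * y.t * (constJ x.α * constJ y.α / constJ (x.α * y.α))⟩ := rfl

theorem one_def : (1 : MetaPair n p) = ⟨1, 1⟩ := rfl

theorem inv_def (x : MetaPair n p) :
    x⁻¹ = ⟨x.α⁻¹, x.t⁻¹ * (constJ x.α * constJ x.α⁻¹)⁻¹⟩ := rfl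

theorem constJ_one : constJ (1 : MetaParab n p) = 1 := by
  simp [constJ, phaseJ_one]

noncomputable instance : Group (MetaPair n p) :=
  Group.ofLeftAxioms
    (fun x y z => by
      simp only [mul_def]
      ext1
      · exact mul_assoc _ _ _
      · simp only [mul_assoc, div_eq_mul_inv]
        generalize constJ (x.α * y.α) = a
        generalize constJ (y.α * z.α) = b
        have : ∀ a b c d e f g h i : Circle,
            a * (b * (c * (d * (e⁻¹ * (f * (e * (g * h))))))) =
            a * (b * (f * (d * (g * (i⁻¹ * (c * (i * h))))))) := by
          intro a b c d e f g h i
          apply Subtype.ext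
          push_cast
          have he : (e : ℂ) ≠ 0 := Circle.coe_ne_zero e
          have hi : (i : ℂ) ≠ 0 := Circle.coe_ne_zero i
          field_simp
        exact this _ _ _ _ _ _ _ _ _)
    (fun x => by
      simp only [mul_def, one_def]
      ext1
      · exact one_mul _
      · simp [constJ_one])
    (fun x => by
      simp only [mul_def, one_def, inv_def]
      ext1
      · exact inv_mul_cancel _
      · simp [constJ_one, mul_comm]
        rw [mul_mul_mul_comm]
        simp)

/-- The homomorphism `(ζ r_P(g), t) ↦ g`. -/
noncomputable def prHom : MetaPair n p →* Parab n p where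
  toFun x := x.α.1
  map_one' := rfl
  map_mul' _ _ := rfl

/-- The character `(ζ r_P(g), t) ↦ t⁻¹ J(r_P(g))⁻¹`. -/
noncomputable def charJ : MetaPair n p →* Circle where
  toFun x := x.t⁻¹ * (phaseJ x.α.1)⁻¹
  map_one' := by simp [one_def, phaseJ_one]
  map_mul' x y := by
    simp only [mul_def, constJ, Prod.fst_mul, Prod.snd_mul]
    apply Subtype.ext
    push_cast
    field_simp

end MetaPair

/-! ### Level structure -/

/-- The data of a fractional ideal `𝔟` and an integral ideal `𝔠` of `ℚ`, given by their positive
generators, with `𝔟⁻¹ ⊆ 2ℤ` and `𝔟𝔠 ⊆ 2ℤ`. -/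
structure Level where
  b : ℚ
  c : ℕ
  b_pos : 0 < b
  c_pos : 0 < c
  b_inv_even : ∃ m : ℤ, b⁻¹ = 2 * m
  bc_even : ∃ m : ℤ, b * c = 2 * m

variable (L : Level)

/-- The group `D_p[𝔟⁻¹, 𝔟𝔠]`, as a subset of `Sp_n(ℚ_p)`; an entry lies in `x ℤ_p` when its norm
is at most that of `x`. -/
def levelSet (L : Level) (n p : ℕ) [Fact p.Prime] : Set (Sp n p) :=
  {g | (∀ i j, ‖g.1.toBlocks₁₁ i j‖ ≤ 1) ∧ (∀ i j, ‖g.1.toBlocks₂₂ i j‖ ≤ 1) ∧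
    (∀ i j, ‖g.1.toBlocks₁₂ i j‖ ≤ ‖((L.b⁻¹ : ℚ) : ℚ_[p])‖) ∧
    (∀ i j, ‖g.1.toBlocks₂₁ i j‖ ≤ ‖((L.b * L.c : ℚ) : ℚ_[p])‖)}

theorem mem_levelSet_iff (g : Parab n p) : g.1 ∈ levelSet L n p ↔
    (∀ i j, ‖blockA g i j‖ ≤ 1) ∧ (∀ i j, ‖blockD g i j‖ ≤ 1) ∧
    (∀ i j, ‖blockB g i j‖ ≤ ‖((L.b⁻¹ : ℚ) : ℚ_[p])‖) := by
  have h : g.1.1.toBlocks₂₁ = 0 := g.2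
  constructor
  · rintro ⟨h1, h2, h3, _⟩
    exact ⟨h1, h2, h3⟩
  · rintro ⟨h1, h2, h3⟩
    exact ⟨h1, h2, h3, fun i j => by
      rw [h, Matrix.zero_apply, norm_zero]; exact norm_nonneg _⟩

theorem norm_mul_apply_le {l m o : Type*} [Fintype m] {A : Matrix l m ℚ_[p]} {B : Matrix m o ℚ_[p]}
    {x y : ℝ} (hx : 0 ≤ x) (hy : 0 ≤ y) (hA : ∀ i j, ‖A i j‖ ≤ x) (hB : ∀ i j, ‖B i j‖ ≤ y)
    (i : l) (j : o) : ‖(A * B) i j‖ ≤ x * y := by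
  rw [Matrix.mul_apply]
  apply IsUltrametricDist.norm_sum_le_of_forall_le_of_nonneg (mul_nonneg hx hy)
  intro k _
  rw [norm_mul]
  exact mul_le_mul (hA i k) (hB k j) (norm_nonneg _) hx

/-- `(D_0)_p = D_p[𝔟⁻¹, 𝔟𝔠] ∩ P_p`. -/
def levelD0 (n p : ℕ) [Fact p.Prime] : Subgroup (Parab n p) where
  carrier := {g | g.1 ∈ levelSet L n p}
  one_mem' := by
    refine (mem_levelSet_iff L _).2 ⟨fun i j => ?_, fun i j => ?_, fun i j => ?_⟩
    · by_cases h : i = j <;> simp [blockA, toBlocks₁₁, Matrix.one_apply, h]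
    · by_cases h : i = j <;> simp [blockD, toBlocks₂₂, Matrix.one_apply, h]
    · have h0 : blockB (1 : Parab n p) i j = 0 := by simp [blockB, toBlocks₁₂]
      rw [h0, norm_zero]
      exact norm_nonneg _
  mul_mem' := by
    intro g h hg hh
    obtain ⟨g1, g2, g3⟩ := (mem_levelSet_iff L g).1 hg
    obtain ⟨h1, h2, h3⟩ := (mem_levelSet_iff L h).1 hh
    refine (mem_levelSet_iff L _).2 ⟨fun i j => ?_, fun i j => ?_, fun i j => ?_⟩
    · rw [blockA_mul]
      simpa using norm_mul_apply_le zero_le_one zero_le_one g1 h1 i j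
    · rw [blockD_mul]
      simpa using norm_mul_apply_le zero_le_one zero_le_one g2 h2 i j
    · rw [blockB_mul, Matrix.add_apply]
      refine (Padic.nonarchimedean _ _).trans (max_le ?_ ?_)
      · simpa using norm_mul_apply_le zero_le_one (norm_nonneg _) g1 h3 i j
      · simpa using norm_mul_apply_le (norm_nonneg _) zero_le_one g3 h2 i j
  inv_mem' := by
    intro g hg
    obtain ⟨g1, g2, g3⟩ := (mem_levelSet_iff L g).1 hg
    refine (mem_levelSet_iff L _).2 ⟨fun i j => ?_, fun i j => ?_, fun i j => ?_⟩
    · rw [blockA_inv]; exact g2 j i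
    · rw [blockD_inv]; exact g1 j i
    · rw [blockB_inv, Matrix.neg_apply, norm_neg]; exact g3 j i

theorem mem_levelD0 (g : Parab n p) : g ∈ levelD0 L n p ↔
    (∀ i j, ‖blockA g i j‖ ≤ 1) ∧ (∀ i j, ‖blockD g i j‖ ≤ 1) ∧
    (∀ i j, ‖blockB g i j‖ ≤ ‖((L.b⁻¹ : ℚ) : ℚ_[p])‖) := mem_levelSet_iff L g

theorem norm_level_le : ‖((L.b⁻¹ : ℚ) : ℚ_[p])‖ ≤ ‖(2 : ℚ_[p])‖ := by
  obtain ⟨m, hm⟩ := L.b_inv_even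
  rw [hm]
  push_cast
  rw [norm_mul]
  exact mul_le_of_le_one_right (norm_nonneg _) (Padic.norm_int_le_one m)

theorem norm_two_le : ‖(2 : ℚ_[p])‖ ≤ 1 := by
  exact_mod_cast Padic.norm_int_le_one (p := p) 2

theorem phaseJ_of_mem {g : Parab n p} (hg : g ∈ levelD0 L n p) : phaseJ g = 1 := by
  obtain ⟨h1, h2, h3⟩ := (mem_levelD0 L g).1 hg
  apply phaseJ_eq_one
  intro x hx
  have hAB : ∀ i j, ‖(blockA g * (blockB g)ᵀ) i j‖ ≤ ‖(2 : ℚ_[p])‖ := by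
    intro i j
    have := norm_mul_apply_le (B := (blockB g)ᵀ) zero_le_one (norm_nonneg (2 : ℚ_[p])) h1
      (fun i j => (h3 j i).trans (norm_level_le L)) i j
    simpa using this
  rw [norm_div, div_le_one (by simp)]
  unfold dotProduct mulVec dotProduct
  apply IsUltrametricDist.norm_sum_le_of_forall_le_of_nonneg (norm_nonneg _)
  intro i _
  rw [norm_mul]
  refine (mul_le_of_le_one_left (norm_nonneg _) (hx i)).trans ?_
  apply IsUltrametricDist.norm_sum_le_of_forall_le_of_nonneg (norm_nonneg _)
  intro j _
  rw [norm_mul]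
  exact (mul_le_of_le_one_right (norm_nonneg _) (hx j)).trans (hAB i j)

open MetaPair in
/-- `(V_0)_p = {(α, 1) | pr(α) ∈ (D_0)_p}`. -/
noncomputable def levelV0 (n p : ℕ) [Fact p.Prime] : Subgroup (MetaPair n p) where
  carrier := {x | x.α.1 ∈ levelD0 L n p ∧ x.t = 1}
  one_mem' := ⟨(levelD0 L n p).one_mem, rfl⟩
  mul_mem' := by
    rintro x y ⟨hx, hx1⟩ ⟨hy, hy1⟩
    have hxy : x.α.1 * y.α.1 ∈ levelD0 L n p := (levelD0 L n p).mul_mem hx hy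
    refine ⟨hxy, ?_⟩
    simp [mul_def, constJ, hx1, hy1, phaseJ_of_mem L hx, phaseJ_of_mem L hy, phaseJ_of_mem L hxy]
    rw [mul_comm, div_self']
  inv_mem' := by
    rintro x ⟨hx, hx1⟩
    have hx' : x.α.1⁻¹ ∈ levelD0 L n p := (levelD0 L n p).inv_mem hx
    refine ⟨hx', ?_⟩
    simp [MetaPair.inv_def, constJ, hx1, phaseJ_of_mem L hx, phaseJ_of_mem L hx']

open MetaPair in
theorem mem_levelV0_iff (x : MetaPair n p) :
    x ∈ levelV0 L n p ↔ prHom x ∈ levelD0 L n p ∧ charJ x = 1 := by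
  constructor
  · rintro ⟨hx, h1⟩
    exact ⟨hx, by simp [charJ, h1, phaseJ_of_mem L hx]⟩
  · rintro ⟨hx, h1⟩
    have hx' : x.α.1 ∈ levelD0 L n p := hx
    refine ⟨hx', ?_⟩
    simpa [charJ, phaseJ_of_mem L hx'] using h1

theorem exists_norm_bound (g : Parab n p) : ∃ C : ℝ, 1 ≤ C ∧ ∀ i j, ‖g.1.1 i j‖ ≤ C := by
  refine ⟨1 + ∑ i, ∑ j, ‖g.1.1 i j‖, ?_, ?_⟩
  · have : 0 ≤ ∑ i, ∑ j, ‖g.1.1 i j‖ :=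
      Finset.sum_nonneg fun i _ => Finset.sum_nonneg fun j _ => norm_nonneg _
    linarith
  · intro i j
    have h1 : ‖g.1.1 i j‖ ≤ ∑ j, ‖g.1.1 i j‖ :=
      Finset.single_le_sum (f := fun j => ‖g.1.1 i j‖) (fun j _ => norm_nonneg _)
        (Finset.mem_univ j)
    have h2 : ∑ j, ‖g.1.1 i j‖ ≤ ∑ i, ∑ j, ‖g.1.1 i j‖ :=
      Finset.single_le_sum (f := fun i => ∑ j, ‖g.1.1 i j‖)
        (fun i _ => Finset.sum_nonneg fun j _ => norm_nonneg _) (Finset.mem_univ i)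
    linarith

theorem entries_of_mem {g : Parab n p} (hg : g ∈ levelD0 L n p) (i j) : ‖g.1.1 i j‖ ≤ 1 := by
  obtain ⟨h1, h2, h3⟩ := (mem_levelD0 L g).1 hg
  rw [coe_eq g]
  rcases i with i | i <;> rcases j with j | j
  · exact h1 i j
  · exact (h3 i j).trans ((norm_level_le L).trans norm_two_le)
  · simp
  · exact h2 i j

theorem mem_levelD0_of_close {g : Parab n p} {ε : ℝ} (h1 : ε ≤ 1)
    (h2 : ε ≤ ‖((L.b⁻¹ : ℚ) : ℚ_[p])‖) (h : ∀ i j, ‖(g.1.1 - 1) i j‖ ≤ ε) :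
    g ∈ levelD0 L n p := by
  have hone : ∀ i j : Fin n ⊕ Fin n, ‖(1 : Matrix (Fin n ⊕ Fin n) (Fin n ⊕ Fin n) ℚ_[p]) i j‖ ≤ 1 := by
    intro i j
    by_cases h : i = j <;> simp [Matrix.one_apply, h]
  have hint : ∀ i j, ‖g.1.1 i j‖ ≤ 1 := by
    intro i j
    have : g.1.1 i j = (g.1.1 - 1) i j + (1 : Matrix _ _ ℚ_[p]) i j := by simp
    rw [this]
    exact (Padic.nonarchimedean _ _).trans (max_le ((h i j).trans h1) (hone i j))
  refine (mem_levelD0 L g).2 ⟨fun i j => hint _ _, fun i j => hint _ _, fun i j => ?_⟩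
  have := h (Sum.inl i) (Sum.inr j)
  simp only [Matrix.sub_apply, Matrix.one_apply, reduceCtorEq, if_false, sub_zero] at this
  exact this.trans h2

open MetaPair HeckeAlg in
/-- Double cosets of `(V_0)_p` are finite unions of right cosets. -/
theorem isHeckePair (n p : ℕ) [Fact p.Prime] : IsHeckePair (levelV0 L n p) := by
  intro w
  set g := prHom w with hg
  obtain ⟨C, hC1, hC⟩ := exists_norm_bound g
  obtain ⟨C', hC1', hC'⟩ := exists_norm_bound g⁻¹
  have hb : 0 < ‖((L.b⁻¹ : ℚ) : ℚ_[p])‖ := by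
    rw [norm_pos_iff]
    exact_mod_cast (inv_pos.2 L.b_pos).ne'
  obtain ⟨N, hN⟩ : ∃ N : ℕ, (p : ℝ) ^ (-(N : ℤ)) < ‖((L.b⁻¹ : ℚ) : ℚ_[p])‖ / (C * C') := by
    have hp1 : (p : ℝ)⁻¹ < 1 := inv_lt_one_of_one_lt₀ (by exact_mod_cast (Fact.out : p.Prime).one_lt)
    obtain ⟨N, hN⟩ := exists_pow_lt_of_lt_one
      (div_pos hb (mul_pos (by linarith : 0 < C) (by linarith : 0 < C'))) hp1
    exact ⟨N, by rwa [_root_.zpow_neg, zpow_natCast, ← inv_pow]⟩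
  have hint : ∀ k : levelV0 L n p, ∀ i j, ‖(prHom (k : MetaPair n p)).1.1 i j‖ ≤ 1 :=
    fun k => entries_of_mem L ((mem_levelV0_iff L _).1 k.2).1
  have : NeZero (p ^ N) := ⟨pow_ne_zero _ (Fact.out : p.Prime).ne_zero⟩
  let F : levelV0 L n p → (Fin n ⊕ Fin n → Fin n ⊕ Fin n → ZMod (p ^ N)) := fun k i j =>
    PadicInt.toZModPow N ⟨(prHom (k : MetaPair n p)).1.1 i j, hint k i j⟩
  have key : ∀ k k', F k = F k' →
      rmk (levelV0 L n p) (w * k) = rmk (levelV0 L n p) (w * k') := by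
    intro k k' h
    rw [rmk_eq, mem_levelV0_iff]
    have hk := (mem_levelV0_iff L _).1 k.2
    have hk' := (mem_levelV0_iff L _).1 k'.2
    constructor
    · set δ := prHom (k : MetaPair n p)
      set δ' := prHom (k' : MetaPair n p)
      have hdiff : ∀ i j, ‖(δ'.1.1 - δ.1.1) i j‖ ≤ (p : ℝ) ^ (-(N : ℤ)) := by
        intro i j
        have h1 := congrFun (congrFun h i) j
        have h2 : (⟨δ'.1.1 i j, hint k' i j⟩ - ⟨δ.1.1 i j, hint k i j⟩ : ℤ_[p]) ∈
            RingHom.ker (PadicInt.toZModPow (p := p) N) := by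
          rw [RingHom.mem_ker]
          exact (map_sub _ _ _).trans (sub_eq_zero.2 h1.symm)
        rw [PadicInt.ker_toZModPow, ← PadicInt.norm_le_pow_iff_mem_span_pow] at h2
        exact h2
      have hδinv : ∀ i j, ‖(δ⁻¹).1.1 i j‖ ≤ 1 :=
        entries_of_mem L ((levelD0 L n p).inv_mem hk.1)
      have hp0 : 0 ≤ (p : ℝ) ^ (-(N : ℤ)) := by positivity
      have hprod : ((prHom (w * (k' : MetaPair n p) * (w * (k : MetaPair n p))⁻¹)).1.1 - 1) =
          g.1.1 * ((δ'.1.1 - δ.1.1) * (δ⁻¹).1.1) * (g⁻¹).1.1 := by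
        have e1 : prHom (w * (k' : MetaPair n p) * (w * (k : MetaPair n p))⁻¹) = g * (δ' * δ⁻¹) * g⁻¹ := by
          simp only [map_mul, map_inv, _root_.mul_inv_rev, ← hg]
          simp only [_root_.mul_assoc]
          rfl
        have e2 : δ.1.1 * (δ⁻¹).1.1 = 1 := by
          have : (δ * δ⁻¹).1.1 = 1 := by rw [mul_inv_cancel]; rfl
          exact this
        have e3 : g.1.1 * (g⁻¹).1.1 = 1 := by
          have : (g * g⁻¹).1.1 = 1 := by rw [mul_inv_cancel]; rfl
          exact this
        rw [e1, Matrix.sub_mul, e2, Matrix.mul_sub, Matrix.sub_mul, Matrix.mul_one, e3]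
        rfl
      apply mem_levelD0_of_close L (ε := ‖((L.b⁻¹ : ℚ) : ℚ_[p])‖)
        ((norm_level_le L).trans norm_two_le) le_rfl
      intro i j
      rw [hprod]
      have b1 := norm_mul_apply_le hp0 zero_le_one hdiff hδinv
      have b2 := norm_mul_apply_le (by linarith) (by positivity) hC b1
      have b3 := norm_mul_apply_le (by positivity) (by linarith) b2 hC' i j
      refine b3.trans ?_
      rw [lt_div_iff₀ (by positivity)] at hN
      nlinarith
    · simp [hk.2, hk'.2]
  have hfin : (Set.range fun k : levelV0 L n p => rmk (levelV0 L n p) (w * k)).Finite := by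
    have : Finite (Set.range F) := inferInstance
    refine Set.Finite.subset (s := Set.range fun y : Set.range F =>
      rmk (levelV0 L n p) (w * (y.2.choose : levelV0 L n p))) (Set.finite_range _) ?_
    rintro _ ⟨k, rfl⟩
    have hk : F k ∈ Set.range F := ⟨k, rfl⟩
    exact ⟨⟨F k, hk⟩, key _ _ hk.choose_spec⟩
  refine hfin.subset ?_
  rintro _ ⟨k, hk, rfl⟩
  exact ⟨⟨k, hk⟩, rfl⟩

/-! ### The local Hecke ring and the map `Φ_p'` -/

open HeckeAlg

/-- The double coset `V_0 (α, t) V_0` in the Hecke ring of `(V_0, W_0)` at `p`. -/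
noncomputable def metaCoset (x : MetaPair n p) : HeckeAlgebra (levelV0 L n p) :=
  dcoset (isHeckePair L n p) x

/-- The relations `V_0 (α, 1) V_0 = t V_0 (α, t) V_0`. -/
inductive FactorRel (L : Level) (n p : ℕ) [Fact p.Prime] :
    HeckeAlgebra (levelV0 L n p) → HeckeAlgebra (levelV0 L n p) → Prop
  | rel (α : MetaParab n p) (t : Circle) :
      FactorRel L n p (metaCoset L ⟨α, 1⟩) ((t : ℂ) • metaCoset L ⟨α, t⟩)

/-- The local Hecke ring `𝒮_{0p}`: the quotient of the Hecke ring of `(V_0, W_0)` at `p` by the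
two-sided ideal generated by all `V_0 (α, 1) V_0 - t V_0 (α, t) V_0`.  It contains the double cosets
`A_r` below, all their products, and the single coset sums coming from the Hecke ring of the whole
symplectic group. -/
abbrev S0 (L : Level) (n p : ℕ) [Fact p.Prime] : Type := RingQuot (FactorRel L n p)

/-- `A_r`, the image of the double coset `V_0 (diag[r̃, r], 1) V_0`. -/
noncomputable def cosetA (r : GL (Fin n) ℚ_[p]) : S0 L n p :=
  RingQuot.mkAlgHom ℂ (FactorRel L n p) (metaCoset L ⟨(diagP r, 1), 1⟩)

/-- The scalar matrix `p I_n`. -/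
noncomputable def scalarP (n p : ℕ) [Fact p.Prime] : GL (Fin n) ℚ_[p] :=
  Matrix.GeneralLinearGroup.scalar (Fin n)
    (Units.mk0 (p : ℚ_[p]) (by exact_mod_cast (Fact.out : p.Prime).ne_zero))

/-- The Frobenius element `U_p`, the double coset of `diag[p⁻¹ I_n, p I_n]`. -/
noncomputable def frobU (n p : ℕ) [Fact p.Prime] : S0 L n p := cosetA L (scalarP n p)

/-- The centraliser of `U_p` in `𝒮_{0p}`. -/
noncomputable def centraliserU (n p : ℕ) [Fact p.Prime] : Subalgebra ℂ (S0 L n p) :=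
  Subalgebra.centralizer ℂ {frobU L n p}

/-- `GL_n(ℤ_p)` as a subgroup of `GL_n(ℚ_p)`. -/
noncomputable def integralGL (n p : ℕ) [Fact p.Prime] : Subgroup (GL (Fin n) ℚ_[p]) :=
  (Matrix.GeneralLinearGroup.map (n := Fin n) (PadicInt.Coe.ringHom (p := p))).range

theorem mem_integralGL {r : GL (Fin n) ℚ_[p]} (h1 : ∀ i j, ‖r.1 i j‖ ≤ 1)
    (h2 : ∀ i j, ‖(r⁻¹).1 i j‖ ≤ 1) : r ∈ integralGL n p := by
  have hinj : Function.Injective fun M : Matrix (Fin n) (Fin n) ℤ_[p] =>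
      M.map (PadicInt.Coe.ringHom (p := p)) := fun M M' h => by
    ext i j
    have h' : (M i j : ℚ_[p]) = (M' i j : ℚ_[p]) := congrFun (congrFun h i) j
    exact Subtype.ext h'
  let u : GL (Fin n) ℤ_[p] :=
    { val := Matrix.of fun i j => ⟨r.1 i j, h1 i j⟩
      inv := Matrix.of fun i j => ⟨(r⁻¹).1 i j, h2 i j⟩
      val_inv := hinj (by
        dsimp only
        rw [Matrix.map_mul, Matrix.map_one _ (map_zero _) (map_one _)]
        exact Units.mul_inv r)
      inv_val := hinj (by
        dsimp only
        rw [Matrix.map_mul, Matrix.map_one _ (map_zero _) (map_one _)]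
        exact Units.inv_mul r) }
  exact ⟨u, by ext i j; rfl⟩

theorem dHom_mem {x : MetaPair n p} (hx : x ∈ levelV0 L n p) :
    dHom (MetaPair.prHom x) ∈ integralGL n p := by
  have h := ((mem_levelV0_iff L x).1 hx).1
  refine mem_integralGL ((mem_levelD0 L _).1 h).2.1 ?_
  rw [← map_inv]
  exact ((mem_levelD0 L _).1 ((levelD0 L n p).inv_mem h)).2.1

theorem norm_map_le (u : GL (Fin n) ℤ_[p]) (i j : Fin n) :
    ‖(Matrix.GeneralLinearGroup.map (PadicInt.Coe.ringHom (p := p)) u).1 i j‖ ≤ 1 :=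
  PadicInt.norm_le_one (u.1 i j)

theorem exists_dHom_eq {r : GL (Fin n) ℚ_[p]} (hr : r ∈ integralGL n p) :
    ∃ x ∈ levelV0 L n p, dHom (MetaPair.prHom x) = r := by
  obtain ⟨u, rfl⟩ := hr
  refine ⟨⟨(diagP (Matrix.GeneralLinearGroup.map PadicInt.Coe.ringHom u), 1), 1⟩, ⟨?_, rfl⟩, ?_⟩
  · refine (mem_levelD0 L _).2 ⟨fun i j => ?_, fun i j => ?_, fun i j => ?_⟩
    · rw [blockA_diagP, ← map_inv]
      exact norm_map_le _ _ _
    · rw [blockD_diagP]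
      exact norm_map_le _ _ _
    · rw [blockB_diagP, Matrix.zero_apply, norm_zero]
      exact norm_nonneg _
  · ext i j
    rfl

/-- The algebra homomorphism from the Hecke ring of `(V_0, W_0)` at `p` to that of
`(GL_n(ℤ_p), GL_n(ℚ_p))`, given on right cosets by
`V_0 (α, t) ↦ t⁻¹ J(r_P(pr α))⁻¹ GL_n(ℤ_p) d_α`. -/
noncomputable def phiLift (n p : ℕ) [Fact p.Prime] :
    HeckeAlgebra (levelV0 L n p) →ₐ[ℂ] HeckeAlgebra (integralGL n p) :=
  push (levelV0 L n p) (integralGL n p) (dHom.comp MetaPair.prHom) MetaPair.charJ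
    (fun _ hx => dHom_mem L hx) (fun x hx => ((mem_levelV0_iff L x).1 hx).2)
    (fun _ hr => exists_dHom_eq L hr)

theorem phiLift_rel {x y : HeckeAlgebra (levelV0 L n p)} (h : FactorRel L n p x y) :
    phiLift L n p x = phiLift L n p y := by
  obtain ⟨α, t⟩ := h
  set z : MetaPair n p := ⟨1, t⟩ with hz
  have hzc : ∀ w, z * w = w * z := by
    intro w
    simp only [hz, MetaPair.mul_def]
    ext1
    · simp
    · simp [MetaPair.constJ_one, mul_comm]
  have hαz : (⟨α, t⟩ : MetaPair n p) = ⟨α, 1⟩ * z := by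
    simp only [hz, MetaPair.mul_def]
    ext1
    · simp
    · simp [MetaPair.constJ_one]
  have hc : MetaPair.charJ z = t⁻¹ := by
    simp [hz, MetaPair.charJ, phaseJ_one]
  have hd : (dHom.comp MetaPair.prHom) z = 1 := by
    have : MetaPair.prHom z = 1 := rfl
    simp [this]
  apply toSum_injective
  rw [map_smul, map_smul, metaCoset, metaCoset, hαz, phiLift, toSum_push, toSum_push,
    toSum_dcoset_mul_central _ hzc, pushSum_transl, hd, hc, transl_one, smul_smul]
  simp

/-- The map `Φ_p'` from `𝒮_{0p}` to the Hecke ring of `(GL_n(ℤ_p), GL_n(ℚ_p))`: if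
`V_0 (diag[r̃, r], 1) V_0` is the union of the right cosets `V_0 (r_P(α), 1)`, then `A_r` is sent to
the sum of the `J(r_P(α))⁻¹ GL_n(ℤ_p) d_α`. -/
noncomputable def phi (n p : ℕ) [Fact p.Prime] :
    S0 L n p →ₐ[ℂ] HeckeAlgebra (integralGL n p) :=
  RingQuot.liftAlgHom ℂ ⟨phiLift L n p, fun _ _ h => phiLift_rel L h⟩

end Metaplectic

/-! The homomorphism (`prHom`, `charJ`) maps W_0 onto P × 𝕋, and V_0 is the preimage of D_0 × 1. The
relations defining 𝒮_{0p} turn the 𝕋-coordinate into a scalar, so 𝒮_{0p} embeds in the Hecke ring of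
(D_0, P) (`proj_injective`). Under this embedding A_r becomes the double coset of diag[r̃, r]
(`proj_cosetA`), and Φ_p' becomes D_0 α ↦ GL_n(ℤ_p) d_α (`dPush_proj`). What remains concerns
finitely supported functions F on D_0 \ P, invariant under D_0 on the right, that commute with the
double coset of π = diag[p⁻¹, p].

Conjugation g ↦ π⁻¹ g π fixes a and d and multiplies b by p², so it maps D_0 into itself. Comparing
coefficients at π g in the two products shows that F(g) ≠ 0 forces F(π g k π⁻¹) ≠ 0 for some k in
D_0 (`exists_ne_zero_of_commute`). After j iterations the b-block has been multiplied by p^(-2j),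
yet it stays bounded because the support is finite. Hence g D_0 contains elements with arbitrarily
small b, and g lies in diag[r̃, r] D_0 with r = d_g (`diagP_inv_mul_mem_of_commute`).

Since D_0 u diag[r̃, r] is the same right coset as D_0 diag[r̃, r] for unipotent u in D_0, the same
conclusion for u diag[r̃, r] forces r to be integral (`norm_le_one_of_commute`). Finally, on its
support F depends only on the coset of d_g, so no cancellation can occur under α ↦ d_α
(`eq_zero_of_commute_of_dPush_eq_zero`). -/

namespace HeckeAlg

/-! ### Coefficients and supports in a Hecke ring. -/

section support

variable {G : Type*} [Group G] {K : Subgroup G}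

theorem transl_apply (g h : G) (A : RCoset K →₀ ℂ) :
    transl K g A (rmk K h) = A (rmk K (h * g⁻¹)) := by
  have hinj : Function.Injective (rmulCoset K g) := fun x y hxy => by
    have := congrArg (rmulCoset K g⁻¹) hxy
    simpa [← rmulCoset_mul, rmulCoset_one] using this
  have hh : rmk K h = rmulCoset K g (rmk K (h * g⁻¹)) := by simp
  rw [hh]
  exact Finsupp.mapDomain_apply hinj _ _

theorem invariants_apply_mul {A : RCoset K →₀ ℂ} (hA : A ∈ invariants K) (g : G) {k : G}
    (hk : k ∈ K) : A (rmk K (g * k)) = A (rmk K g) := by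
  have h := transl_apply k (g * k) A
  rw [hA k hk, mul_inv_cancel_right] at h
  exact h

theorem rmk_mul_left (g : G) {k : G} (hk : k ∈ K) : rmk K (k * g) = rmk K g := by
  rw [rmk_eq]
  simpa using K.inv_mem hk

theorem exists_out_eq (g : G) : ∃ k ∈ K, (rmk K g).out = k * g := by
  refine ⟨(rmk K g).out * g⁻¹, ?_, by simp⟩
  rw [← rmk_eq, rmk_out]

theorem convolve_apply (A B : RCoset K →₀ ℂ) (h : G) :
    convolve K A B (rmk K h) = B.sum fun y c => c * A (rmk K (h * y.out⁻¹)) := by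
  simp [convolve, Finsupp.linearCombination_apply, transl_apply]

open Classical in
theorem dcoset_apply (hK : IsHeckePair K) (g : G) (y : RCoset K) :
    toSum K (dcoset hK g) y = if y ∈ cosetsIn K g then 1 else 0 := by
  change (∑ z ∈ (hK g).toFinset, Finsupp.single z (1 : ℂ)) y = _
  simp [Finsupp.finsetSum_apply, Finsupp.single_apply]

theorem invariants_apply_of_mem_cosetsIn {A : RCoset K →₀ ℂ} (hA : A ∈ invariants K) {g : G}
    {y : RCoset K} (hy : y ∈ cosetsIn K g) : A y = A (rmk K g) := by
  obtain ⟨k, hk, rfl⟩ := hy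
  exact invariants_apply_mul hA g hk

/-- An element of the Hecke ring whose support is covered by the double cosets of the elements of
`S` is a linear combination of these double cosets. -/
theorem mem_span_dcoset (hK : IsHeckePair K) (S : Set G) (A : HeckeAlgebra K)
    (hS : ∀ y, toSum K A y ≠ 0 → ∃ g ∈ S, y ∈ cosetsIn K g) :
    A ∈ Submodule.span ℂ (dcoset hK '' S) := by
  classical
  induction hm : (toSum K A).support.card using Nat.strong_induction_on generalizing A with
  | _ m ih =>
    by_cases h0 : toSum K A = 0
    · rw [toSum_injective K (h0.trans (map_zero _).symm)]
      exact zero_mem _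
    obtain ⟨y, hy⟩ := Finsupp.ne_iff.1 h0
    obtain ⟨g, hg, hyg⟩ := hS y hy
    -- Invariance makes the coefficients of A constant on K g K, so subtracting this multiple clears
    -- that whole double coset and changes nothing elsewhere. The support shrinks strictly.
    set A' := A - (toSum K A y) • dcoset hK g with hA'
    have happ : ∀ z, toSum K A' z
        = toSum K A z - toSum K A y * (if z ∈ cosetsIn K g then 1 else 0) := by
      intro z
      rw [hA', map_sub, map_smul, Finsupp.sub_apply, Finsupp.smul_apply, dcoset_apply, smul_eq_mul]
    have hval : ∀ z ∈ cosetsIn K g, toSum K A z = toSum K A y := fun z hz =>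
      (invariants_apply_of_mem_cosetsIn (toSum_mem K A) hz).trans
        (invariants_apply_of_mem_cosetsIn (toSum_mem K A) hyg).symm
    have hne : ∀ z, toSum K A' z ≠ 0 → toSum K A z ≠ 0 := by
      intro z hz h
      apply hz
      rw [happ]
      split_ifs with hzg
      · rw [hval z hzg]; ring
      · rw [h]; ring
    have hss : (toSum K A').support ⊂ (toSum K A).support := by
      refine (Finset.ssubset_iff_of_subset fun z hz => ?_).2 ⟨y, ?_, ?_⟩
      · exact Finsupp.mem_support_iff.2 (hne z (Finsupp.mem_support_iff.1 hz))
      · exact Finsupp.mem_support_iff.2 hy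
      · rw [Finsupp.mem_support_iff, not_not, happ, if_pos hyg]; ring
    have h1 := ih _ (hm ▸ Finset.card_lt_card hss) A' (fun z hz => hS z (hne z hz)) rfl
    have h2 : A = A' + (toSum K A y) • dcoset hK g := by rw [hA']; abel
    rw [h2]
    exact add_mem h1 (Submodule.smul_mem _ _ (Submodule.subset_span ⟨g, hg, rfl⟩))

end support

/-! ### Images of double cosets under homomorphisms of Hecke pairs. -/

section push

variable {G H : Type*} [Group G] [Group H] {K : Subgroup G} {L : Subgroup H}
  {f : G →* H} {χ : G →* Circle}

/-- The character is constant on the elements g k, so `hmem` prevents distinct cosets K g k from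
having the same image under f. Surjectivity of K → L shows that every coset in the target double
coset is reached, so each occurs exactly once. -/
theorem push_dcoset (hf : ∀ k ∈ K, f k ∈ L) (hχ : ∀ k ∈ K, χ k = 1)
    (hL : ∀ l ∈ L, ∃ k ∈ K, f k = l) (hmem : ∀ x, f x ∈ L → χ x = 1 → x ∈ K)
    (hK : IsHeckePair K) (hLp : IsHeckePair L) (g : G) :
    push K L f χ hf hχ hL (dcoset hK g) = (χ g : ℂ) • dcoset hLp (f g) := by
  apply toSum_injective
  rw [toSum_push, map_smul]
  change pushSum K L f χ hf hχ (∑ y ∈ (hK g).toFinset, Finsupp.single y (1 : ℂ))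
    = (χ g : ℂ) • ∑ y ∈ (hLp (f g)).toFinset, Finsupp.single y (1 : ℂ)
  rw [map_sum, Finset.smul_sum]
  have hpush : ∀ k ∈ K, pushSum K L f χ hf hχ (Finsupp.single (rmk K (g * k)) 1)
      = (χ g : ℂ) • Finsupp.single (rmk L (f g * f k)) 1 := by
    intro k hk
    rw [pushSum_single, map_mul, map_mul, hχ k hk]
    simp
  have hlift : ∀ x y : G, y * x⁻¹ ∈ K → rmk L (f x) = rmk L (f y) := by
    intro x y h
    rw [rmk_eq]
    simpa using hf _ h
  let F : RCoset K → RCoset L := Quotient.lift (fun x => rmk L (f x)) fun x y h =>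
    hlift x y (QuotientGroup.rightRel_apply.1 h)
  have hF : ∀ x, F (rmk K x) = rmk L (f x) := fun _ => rfl
  refine Finset.sum_bij (fun y _ => F y) ?_ ?_ ?_ ?_
  · intro y hy
    obtain ⟨k, hk, rfl⟩ := (hK g).mem_toFinset.1 hy
    exact (hLp _).mem_toFinset.2 ⟨f k, hf k hk, by rw [hF, map_mul]⟩
  · intro y hy z hz hyz
    obtain ⟨k, hk, rfl⟩ := (hK g).mem_toFinset.1 hy
    obtain ⟨l, hl, rfl⟩ := (hK g).mem_toFinset.1 hz
    rw [hF, hF, rmk_eq] at hyz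
    rw [rmk_eq]
    refine hmem _ (by simpa using hyz) ?_
    simp [hχ k hk, hχ l hl]
  · intro y hy
    obtain ⟨l, hl, rfl⟩ := (hLp _).mem_toFinset.1 hy
    obtain ⟨k, hk, rfl⟩ := hL l hl
    exact ⟨rmk K (g * k), (hK g).mem_toFinset.2 ⟨k, hk, rfl⟩, by rw [hF, map_mul]⟩
  · intro y hy
    obtain ⟨k, hk, rfl⟩ := (hK g).mem_toFinset.1 hy
    rw [hpush k hk, hF, map_mul]

theorem IsHeckePair.of_map (hf : ∀ k ∈ K, f k ∈ L) (hL : ∀ l ∈ L, ∃ k ∈ K, f k = l)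
    (hsurj : Function.Surjective f) (hK : IsHeckePair K) : IsHeckePair L := by
  intro h
  obtain ⟨g, rfl⟩ := hsurj h
  let F : RCoset K → RCoset L := Quotient.lift (fun x => rmk L (f x)) fun x y h => by
    rw [rmk_eq]
    simpa using hf _ (QuotientGroup.rightRel_apply.1 h)
  refine ((hK g).image F).subset ?_
  rintro _ ⟨l, hl, rfl⟩
  obtain ⟨k, hk, rfl⟩ := hL l hl
  refine ⟨rmk K (g * k), ⟨k, hk, rfl⟩, ?_⟩
  change rmk L (f (g * k)) = _
  rw [map_mul]

end push

end HeckeAlg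

/-! ### Embedding of 𝒮_{0p} into the Hecke ring of (D_0, P). -/

namespace Metaplectic

open HeckeAlg

variable {n p : ℕ} [Fact p.Prime] (L : Level)

theorem prHom_mem {x : MetaPair n p} (hx : x ∈ levelV0 L n p) :
    MetaPair.prHom x ∈ levelD0 L n p := ((mem_levelV0_iff L x).1 hx).1

theorem charJ_of_mem {x : MetaPair n p} (hx : x ∈ levelV0 L n p) : MetaPair.charJ x = 1 :=
  ((mem_levelV0_iff L x).1 hx).2

/-- The splitting `g ↦ (r_P(g), J(r_P(g))⁻¹)` of `W_0 → P_p`, on which `charJ` is trivial. -/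
noncomputable def splitHom : Parab n p →* MetaPair n p where
  toFun g := ⟨(g, 1), (phaseJ g)⁻¹⟩
  map_one' := by
    rw [phaseJ_one]
    simp [MetaPair.one_def]
  map_mul' g h := by
    rw [MetaPair.mul_def]
    ext1
    · simp
    · simp only [constJ, Prod.mk_mul_mk]
      apply Subtype.ext
      push_cast
      field_simp

theorem prHom_splitHom (g : Parab n p) : MetaPair.prHom (splitHom g) = g := rfl

theorem charJ_splitHom (g : Parab n p) : MetaPair.charJ (splitHom g) = 1 := by
  change (phaseJ g)⁻¹⁻¹ * (phaseJ g)⁻¹ = 1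
  simp

theorem splitHom_mem {g : Parab n p} (hg : g ∈ levelD0 L n p) : splitHom g ∈ levelV0 L n p :=
  (mem_levelV0_iff L _).2 ⟨hg, charJ_splitHom g⟩

theorem exists_prHom_eq {g : Parab n p} (hg : g ∈ levelD0 L n p) :
    ∃ x ∈ levelV0 L n p, MetaPair.prHom x = g :=
  ⟨splitHom g, splitHom_mem L hg, rfl⟩

theorem isHeckePair_levelD0 (n p : ℕ) [Fact p.Prime] : IsHeckePair (levelD0 L n p) :=
  IsHeckePair.of_map (fun _ hx => prHom_mem L hx) (fun _ hg => exists_prHom_eq L hg)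
    (fun g => ⟨splitHom g, rfl⟩) (isHeckePair L n p)

theorem central_mul_comm (t : Circle) (w : MetaPair n p) :
    (⟨1, t⟩ : MetaPair n p) * w = w * ⟨1, t⟩ := by
  simp only [MetaPair.mul_def]
  ext1
  · simp
  · simp [MetaPair.constJ_one, mul_comm]

theorem mk_central_mul (α : MetaParab n p) (t : Circle) :
    (⟨α, 1⟩ : MetaPair n p) * ⟨1, t⟩ = ⟨α, t⟩ := by
  rw [MetaPair.mul_def]
  ext1
  · simp
  · simp [MetaPair.constJ_one]

theorem charJ_central (t : Circle) : MetaPair.charJ (⟨1, t⟩ : MetaPair n p) = t⁻¹ := by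
  simp [MetaPair.charJ, phaseJ_one]

theorem mkAlgHom_metaCoset (α : MetaParab n p) (t : Circle) :
    RingQuot.mkAlgHom ℂ (FactorRel L n p) (metaCoset L ⟨α, 1⟩)
      = (t : ℂ) • RingQuot.mkAlgHom ℂ (FactorRel L n p) (metaCoset L ⟨α, t⟩) := by
  rw [← map_smul]
  exact RingQuot.mkAlgHom_rel ℂ (FactorRel.rel α t)

/-- The defining relations start from the 𝕋-coordinate 1. Comparing the two relations that lead to
`x.t` and to `x.t * t`, and cancelling `x.t`, gives the shift from an arbitrary x. -/
theorem mkAlgHom_metaCoset_mul_central (x : MetaPair n p) (t : Circle) :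
    RingQuot.mkAlgHom ℂ (FactorRel L n p) (metaCoset L x)
      = (t : ℂ) • RingQuot.mkAlgHom ℂ (FactorRel L n p) (metaCoset L (x * ⟨1, t⟩)) := by
  have h1 := mkAlgHom_metaCoset L x.α x.t
  have h2 := mkAlgHom_metaCoset L x.α (x.t * t)
  have h3 : x * ⟨1, t⟩ = ⟨x.α, x.t * t⟩ := by
    rw [MetaPair.mul_def]
    ext1
    · simp
    · simp [MetaPair.constJ_one]
  rw [h3]
  rw [h1, Circle.coe_mul, mul_smul] at h2
  exact smul_right_injective _ (Circle.coe_ne_zero x.t) h2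

/-- The homomorphism from the Hecke ring of `(V_0, W_0)` to that of `(D_0, P)`. -/
noncomputable def projLift (n p : ℕ) [Fact p.Prime] :
    HeckeAlgebra (levelV0 L n p) →ₐ[ℂ] HeckeAlgebra (levelD0 L n p) :=
  push (levelV0 L n p) (levelD0 L n p) MetaPair.prHom MetaPair.charJ
    (fun _ hx => prHom_mem L hx) (fun _ hx => charJ_of_mem L hx) (fun _ hg => exists_prHom_eq L hg)

theorem projLift_metaCoset (x : MetaPair n p) :
    projLift L n p (metaCoset L x)
      = (MetaPair.charJ x : ℂ) • dcoset (isHeckePair_levelD0 L n p) (MetaPair.prHom x) :=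
  push_dcoset _ _ _ (fun x h1 h2 => (mem_levelV0_iff L x).2 ⟨h1, h2⟩) _ _ x

theorem projLift_rel {x y : HeckeAlgebra (levelV0 L n p)} (h : FactorRel L n p x y) :
    projLift L n p x = projLift L n p y := by
  obtain ⟨α, t⟩ := h
  rw [map_smul, projLift_metaCoset, projLift_metaCoset, smul_smul, ← mk_central_mul α t, map_mul,
    map_mul, charJ_central]
  congr 1
  -- The scalar t of the relation cancels the value t⁻¹ of the character at (1, t).
  · rw [Circle.coe_mul, mul_left_comm, ← Circle.coe_mul, mul_inv_cancel, Circle.coe_one, mul_one]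
  · congr 1
    exact (mul_one _).symm

/-- The map from `𝒮_{0p}` to the Hecke ring of `(D_0, P)` induced by `W_0 → P`. -/
noncomputable def proj (n p : ℕ) [Fact p.Prime] :
    S0 L n p →ₐ[ℂ] HeckeAlgebra (levelD0 L n p) :=
  RingQuot.liftAlgHom ℂ ⟨projLift L n p, fun _ _ h => projLift_rel L h⟩

theorem proj_mk (x : HeckeAlgebra (levelV0 L n p)) :
    proj L n p (RingQuot.mkAlgHom ℂ (FactorRel L n p) x) = projLift L n p x :=
  RingQuot.liftAlgHom_mkAlgHom_apply ..

/-- The linear map `D_0 g ↦ V_0 (r_P(g), J(r_P(g))⁻¹)` of formal sums of right cosets. -/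
noncomputable def splitSum (n p : ℕ) [Fact p.Prime] :
    (RCoset (levelD0 L n p) →₀ ℂ) →ₗ[ℂ] (RCoset (levelV0 L n p) →₀ ℂ) :=
  pushSum (levelD0 L n p) (levelV0 L n p) splitHom 1 (fun _ hg => splitHom_mem L hg)
    (fun _ _ => rfl)

/-- V_0 contains the common kernel of `prHom` and `charJ`; in particular the phase ζ of ζ r_P(g) is
invisible to right cosets. -/
theorem rmk_levelV0_eq {x y : MetaPair n p} (h1 : MetaPair.prHom x = MetaPair.prHom y)
    (h2 : MetaPair.charJ x = MetaPair.charJ y) :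
    rmk (levelV0 L n p) x = rmk (levelV0 L n p) y := by
  rw [rmk_eq, mem_levelV0_iff, map_mul, map_mul, map_inv, map_inv, h1, h2, mul_inv_cancel,
    mul_inv_cancel]
  exact ⟨one_mem _, rfl⟩

theorem prHom_central (t : Circle) : MetaPair.prHom (⟨1, t⟩ : MetaPair n p) = 1 := rfl

theorem rmk_splitHom (x : MetaPair n p) :
    rmk (levelV0 L n p) (splitHom (MetaPair.prHom x))
      = rmk (levelV0 L n p) (x * ⟨1, MetaPair.charJ x⟩) := by
  apply rmk_levelV0_eq L
  · rw [map_mul, prHom_central, mul_one, prHom_splitHom]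
  · rw [map_mul, charJ_central, mul_inv_cancel, charJ_splitHom]

theorem splitSum_mem {A : RCoset (levelD0 L n p) →₀ ℂ} (hA : A ∈ invariants (levelD0 L n p)) :
    splitSum L n p A ∈ invariants (levelV0 L n p) := by
  intro v hv
  have h1 : transl (levelV0 L n p) (splitHom (MetaPair.prHom v)) (splitSum L n p A)
      = splitSum L n p A := by
    have h := pushSum_transl (levelD0 L n p) (levelV0 L n p) splitHom 1
      (fun _ hg => splitHom_mem L hg) (fun _ _ => rfl) (MetaPair.prHom v) A
    rw [hA _ (prHom_mem L hv)] at h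
    simpa [splitSum] using h.symm
  -- V_0 is larger than the image of D_0 under `splitHom`, since it contains the phases ζ. They do
  -- not matter: v and the lift of its projection have the same invariants, hence act alike on right
  -- cosets.
  have h2 : ∀ B : RCoset (levelV0 L n p) →₀ ℂ, transl (levelV0 L n p) v B
      = transl (levelV0 L n p) (splitHom (MetaPair.prHom v)) B := by
    intro B
    induction B using Finsupp.induction_linear with
    | zero => simp
    | add f g hf hg => simp [hf, hg]
    | single y c =>
      rw [← rmk_out _ y, transl_single, transl_single, rmulCoset_rmk, rmulCoset_rmk]
      congr 1
      apply rmk_levelV0_eq L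
      · rw [map_mul, map_mul, prHom_splitHom]
      · rw [map_mul, map_mul, charJ_splitHom, charJ_of_mem L hv]
  rw [h2, h1]

/-- The linear map from the Hecke ring of `(D_0, P)` to that of `(V_0, W_0)` given by
`splitSum`. -/
noncomputable def splitLin (n p : ℕ) [Fact p.Prime] :
    HeckeAlgebra (levelD0 L n p) →ₗ[ℂ] HeckeAlgebra (levelV0 L n p) where
  toFun A := ofSum _ (splitSum L n p (toSum _ A)) (splitSum_mem L (toSum_mem _ A))
  map_add' A B := toSum_injective _ (by simp)
  map_smul' c A := toSum_injective _ (by simp)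

theorem toSum_splitLin (A : HeckeAlgebra (levelD0 L n p)) :
    toSum _ (splitLin L n p A) = splitSum L n p (toSum _ A) := rfl

/-- Projecting and splitting again moves x by a central element to the point where the character is
1. The scalar that appears is exactly the one absorbed by the relations of 𝒮_{0p}. -/
theorem splitLin_projLift_metaCoset (x : MetaPair n p) :
    splitLin L n p (projLift L n p (metaCoset L x))
      = (MetaPair.charJ x : ℂ) • metaCoset L (x * ⟨1, MetaPair.charJ x⟩) := by
  apply toSum_injective
  rw [toSum_splitLin, map_smul, metaCoset, metaCoset,
    toSum_dcoset_mul_central _ (central_mul_comm _)]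
  rw [projLift, toSum_push]
  change splitSum L n p (pushSum _ _ _ _ (fun _ hx => prHom_mem L hx)
      (fun _ hx => charJ_of_mem L hx)
      (∑ y ∈ (isHeckePair L n p x).toFinset, Finsupp.single y (1 : ℂ)))
    = (MetaPair.charJ x : ℂ) • transl _ _
      (∑ y ∈ (isHeckePair L n p x).toFinset, Finsupp.single y (1 : ℂ))
  rw [map_sum, map_sum, map_sum, Finset.smul_sum]
  refine Finset.sum_congr rfl fun y hy => ?_
  obtain ⟨k, hk, rfl⟩ := (isHeckePair L n p x).mem_toFinset.1 hy
  have hJ : MetaPair.charJ (x * k) = MetaPair.charJ x := by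
    rw [map_mul, charJ_of_mem L hk, mul_one]
  rw [pushSum_single, map_smul, splitSum, pushSum_single, rmk_splitHom, transl_single, hJ,
    rmulCoset_rmk]
  simp

/-- A linear left inverse of `proj` is enough for injectivity, so multiplicativity of the splitting
is never needed. Double cosets span the Hecke ring, and on each of them the claim is the previous
computation combined with the relations. -/
theorem mk_splitLin_proj (A : S0 L n p) :
    RingQuot.mkAlgHom ℂ (FactorRel L n p) (splitLin L n p (proj L n p A)) = A := by
  obtain ⟨a, rfl⟩ := RingQuot.mkAlgHom_surjective ℂ (FactorRel L n p) A
  rw [proj_mk]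
  have ha : a ∈ Submodule.span ℂ (dcoset (isHeckePair L n p) '' Set.univ) := by
    refine mem_span_dcoset _ _ a fun y _ => ⟨y.out, trivial, 1, one_mem _, ?_⟩
    rw [mul_one, rmk_out]
  induction ha using Submodule.span_induction with
  | mem a h =>
    obtain ⟨x, _, rfl⟩ := h
    have h1 := splitLin_projLift_metaCoset L x
    have h2 := mkAlgHom_metaCoset_mul_central L x (MetaPair.charJ x)
    change RingQuot.mkAlgHom ℂ (FactorRel L n p) (splitLin L n p (projLift L n p (metaCoset L x)))
      = RingQuot.mkAlgHom ℂ (FactorRel L n p) (metaCoset L x)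
    rw [h1, map_smul, h2]
  | zero => simp
  | add a b _ _ h1 h2 => rw [map_add, map_add, map_add, map_add, h1, h2]
  | smul c a _ h => rw [map_smul, map_smul, map_smul, map_smul, h]

theorem proj_injective : Function.Injective (proj L n p) := fun A B h => by
  rw [← mk_splitLin_proj L A, h, mk_splitLin_proj]

/-- With b = 0 the quadratic exponential is 1, so the Gauss sum has no phase. -/
theorem charJ_diagP (r : GL (Fin n) ℚ_[p]) :
    MetaPair.charJ (⟨(diagP r, 1), 1⟩ : MetaPair n p) = 1 := by
  have : phaseJ (diagP r) = 1 := phaseJ_eq_one _ fun x _ => by simp [blockB_diagP]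
  simp [MetaPair.charJ, this]

theorem proj_cosetA (r : GL (Fin n) ℚ_[p]) :
    proj L n p (cosetA L r) = dcoset (isHeckePair_levelD0 L n p) (diagP r) := by
  rw [cosetA, proj_mk, projLift_metaCoset, charJ_diagP, Circle.coe_one, one_smul]
  rfl

theorem dHom_mem_integralGL {x : Parab n p} (hx : x ∈ levelD0 L n p) : dHom x ∈ integralGL n p := by
  have h := dHom_mem L (splitHom_mem L hx)
  rwa [prHom_splitHom] at h

/-- The homomorphism `D_0 α ↦ GL_n(ℤ_p) d_α` of Hecke rings. -/
noncomputable def dPush (n p : ℕ) [Fact p.Prime] :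
    HeckeAlgebra (levelD0 L n p) →ₐ[ℂ] HeckeAlgebra (integralGL n p) :=
  push (levelD0 L n p) (integralGL n p) dHom 1 (fun _ hx => dHom_mem_integralGL L hx) (fun _ _ => rfl)
    (fun r hr => by
      obtain ⟨x, hx, h⟩ := exists_dHom_eq L hr
      exact ⟨MetaPair.prHom x, prHom_mem L hx, h⟩)

/-- The factor t⁻¹ J⁻¹ of Φ_p' is already contained in `proj`, which leaves the untwisted map α ↦
d_α. -/
theorem dPush_proj (A : S0 L n p) : dPush L n p (proj L n p A) = phi L n p A := by
  obtain ⟨a, rfl⟩ := RingQuot.mkAlgHom_surjective ℂ (FactorRel L n p) A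
  rw [proj_mk, phi, RingQuot.liftAlgHom_mkAlgHom_apply]
  apply toSum_injective
  rw [dPush, projLift, phiLift, toSum_push, toSum_push, toSum_push]
  generalize toSum _ a = B
  induction B using Finsupp.induction_linear with
  | zero => simp
  | add f g hf hg => simp only [map_add, hf, hg]
  | single y c =>
    rw [← rmk_out _ y, pushSum_single, pushSum_single, map_smul, pushSum_single]
    simp

end Metaplectic

/-! ### Diagonal and unipotent elements, and conjugation by π. -/

namespace Metaplectic

open HeckeAlg

variable {n p : ℕ} [Fact p.Prime] (L : Level)

theorem parab_ext {g h : Parab n p} (hA : blockA g = blockA h) (hB : blockB g = blockB h)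
    (hD : blockD g = blockD h) : g = h := by
  apply Subtype.ext
  apply Subtype.ext
  rw [coe_eq g, coe_eq h, hA, hB, hD]

theorem diagP_mul (r s : GL (Fin n) ℚ_[p]) : diagP (r * s) = diagP r * diagP s := by
  refine parab_ext ?_ ?_ ?_
  · rw [blockA_mul, blockA_diagP, blockA_diagP, blockA_diagP, ← transpose_mul, _root_.mul_inv_rev]
    rfl
  · rw [blockB_mul, blockB_diagP, blockB_diagP, blockB_diagP]
    simp
  · rw [blockD_mul, blockD_diagP, blockD_diagP, blockD_diagP]
    rfl

theorem diagP_one : diagP (1 : GL (Fin n) ℚ_[p]) = 1 := by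
  have h := diagP_mul (1 : GL (Fin n) ℚ_[p]) 1
  rwa [mul_one, left_eq_mul] at h

theorem diagP_inv (r : GL (Fin n) ℚ_[p]) : (diagP r)⁻¹ = diagP r⁻¹ := by
  rw [inv_eq_iff_mul_eq_one, ← diagP_mul, mul_inv_cancel, diagP_one]

theorem diagP_mem {r : GL (Fin n) ℚ_[p]} (hr : r ∈ integralGL n p) : diagP r ∈ levelD0 L n p := by
  obtain ⟨u, rfl⟩ := hr
  refine (mem_levelD0 L _).2 ⟨fun i j => ?_, fun i j => ?_, fun i j => ?_⟩
  · rw [blockA_diagP, ← map_inv]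
    exact norm_map_le _ _ _
  · rw [blockD_diagP]
    exact norm_map_le _ _ _
  · rw [blockB_diagP, Matrix.zero_apply, norm_zero]
    exact norm_nonneg _

/-- The unipotent element `(1 x; 0 1)` for a symmetric matrix `x`. -/
noncomputable def unip (x : Matrix (Fin n) (Fin n) ℚ_[p]) (hx : xᵀ = x) : Parab n p :=
  ⟨⟨fromBlocks 1 x 0 1, by
    rw [SymplecticGroup.mem_iff, Matrix.J, fromBlocks_transpose, fromBlocks_multiply,
      fromBlocks_multiply]
    simp [hx]⟩,
    by
      change (fromBlocks _ _ _ _ : Matrix _ _ ℚ_[p]).toBlocks₂₁ = 0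
      simp⟩

theorem blockB_unip (x : Matrix (Fin n) (Fin n) ℚ_[p]) (hx : xᵀ = x) :
    blockB (unip x hx) = x := rfl
theorem blockD_unip (x : Matrix (Fin n) (Fin n) ℚ_[p]) (hx : xᵀ = x) :
    blockD (unip x hx) = 1 := rfl

theorem transpose_blockD_mul_blockA (g : Parab n p) : (blockD g)ᵀ * blockA g = 1 := by
  rw [← blockA_inv, ← blockA_mul, inv_mul_cancel]
  ext i j
  simp [blockA, toBlocks₁₁, Matrix.one_apply]

/-- The element `π = diag[p⁻¹, p]`. -/
noncomputable def frobP (n p : ℕ) [Fact p.Prime] : Parab n p := diagP (scalarP n p)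

theorem coe_scalarP : (scalarP n p).1 = (p : ℚ_[p]) • (1 : Matrix (Fin n) (Fin n) ℚ_[p]) := by
  exact (Matrix.smul_one_eq_diagonal _).symm

theorem coe_scalarP_inv :
    ((scalarP n p)⁻¹).1 = (p : ℚ_[p])⁻¹ • (1 : Matrix (Fin n) (Fin n) ℚ_[p]) := by
  rw [scalarP, ← map_inv]
  exact (Matrix.smul_one_eq_diagonal _).symm

theorem natCast_prime_ne_zero : (p : ℚ_[p]) ≠ 0 := by exact_mod_cast (Fact.out : p.Prime).ne_zero

theorem frobP_blocks : blockA (frobP n p) = (p : ℚ_[p])⁻¹ • 1 ∧ blockB (frobP n p) = 0 ∧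
    blockD (frobP n p) = (p : ℚ_[p]) • 1 := by
  refine ⟨?_, rfl, coe_scalarP⟩
  rw [frobP, blockA_diagP, coe_scalarP_inv]
  simp

theorem frobP_inv_blocks : blockA (frobP n p)⁻¹ = (p : ℚ_[p]) • 1 ∧ blockB (frobP n p)⁻¹ = 0 ∧
    blockD (frobP n p)⁻¹ = (p : ℚ_[p])⁻¹ • 1 := by
  obtain ⟨h1, h2, h3⟩ := frobP_blocks (n := n) (p := p)
  rw [blockA_inv, blockB_inv, blockD_inv, h1, h2, h3]
  simp

/-- The blocks of π are scalar, so they cancel on the diagonal and act on b by p · p. This p-adic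
contraction of b drives the whole argument. -/
theorem conj_inv_frobP_blocks (g : Parab n p) :
    blockA ((frobP n p)⁻¹ * g * frobP n p) = blockA g ∧
    blockB ((frobP n p)⁻¹ * g * frobP n p) = (p : ℚ_[p]) ^ 2 • blockB g ∧
    blockD ((frobP n p)⁻¹ * g * frobP n p) = blockD g := by
  obtain ⟨h1, h2, h3⟩ := frobP_blocks (n := n) (p := p)
  obtain ⟨h4, h5, h6⟩ := frobP_inv_blocks (n := n) (p := p)
  have hp := natCast_prime_ne_zero (p := p)
  refine ⟨?_, ?_, ?_⟩
  · rw [blockA_mul, blockA_mul, h1, h4]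
    simp [smul_smul, hp]
  · rw [blockB_mul, blockB_mul, blockA_mul, h2, h3, h4, h5]
    simp [smul_smul, pow_two]
  · rw [blockD_mul, blockD_mul, h3, h6]
    simp [smul_smul, hp]

theorem conj_frobP_mem {k : Parab n p} (hk : k ∈ levelD0 L n p) :
    (frobP n p)⁻¹ * k * frobP n p ∈ levelD0 L n p := by
  obtain ⟨h1, h2, h3⟩ := conj_inv_frobP_blocks k
  obtain ⟨k1, k2, k3⟩ := (mem_levelD0 L k).1 hk
  rw [mem_levelD0, h1, h2, h3]
  refine ⟨k1, k2, fun i j => ?_⟩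
  rw [Matrix.smul_apply, smul_eq_mul, norm_mul]
  refine (mul_le_of_le_one_left (norm_nonneg _) ?_).trans (k3 i j)
  rw [norm_pow]
  exact pow_le_one₀ (norm_nonneg _) (by exact_mod_cast Padic.norm_int_le_one (p := p) p)

theorem conj_pow_frobP_mem {k : Parab n p} (hk : k ∈ levelD0 L n p) (j : ℕ) :
    (frobP n p ^ j)⁻¹ * k * frobP n p ^ j ∈ levelD0 L n p := by
  induction j with
  | zero => simpa using hk
  | succ j ih =>
    have h := conj_frobP_mem L ih
    have e : (frobP n p ^ (j + 1))⁻¹ * k * frobP n p ^ (j + 1)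
        = (frobP n p)⁻¹ * ((frobP n p ^ j)⁻¹ * k * frobP n p ^ j) * frobP n p := by
      rw [pow_succ]
      group
    rwa [e]

theorem blockB_conj_inv_pow (g : Parab n p) (j : ℕ) :
    blockB ((frobP n p ^ j)⁻¹ * g * frobP n p ^ j) = (p : ℚ_[p]) ^ (2 * j) • blockB g := by
  induction j with
  | zero => simp
  | succ j ih =>
    have e : (frobP n p ^ (j + 1))⁻¹ * g * frobP n p ^ (j + 1)
        = (frobP n p)⁻¹ * ((frobP n p ^ j)⁻¹ * g * frobP n p ^ j) * frobP n p := by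
      rw [pow_succ]
      group
    rw [e, (conj_inv_frobP_blocks _).2.1, ih, smul_smul]
    congr 1
    ring

/-! ### The centraliser of the double coset of π. -/

/-- The double coset of `π` in the Hecke ring of `(D_0, P)`. -/
noncomputable def frobD (n p : ℕ) [Fact p.Prime] : HeckeAlgebra (levelD0 L n p) :=
  dcoset (isHeckePair_levelD0 L n p) (frobP n p)

/-- A coset D_0 y contributes only if k y g⁻¹ lies in π⁻¹ D_0 π for some k in D_0. As π⁻¹ D_0 π ⊆
D_0, the coset D_0 g is the only one, so left multiplication carries coefficients from g to π g
without mixing them. -/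
theorem frobD_mul_apply (F : HeckeAlgebra (levelD0 L n p)) (g : Parab n p) :
    toSum _ (frobD L n p * F) (rmk _ (frobP n p * g)) = toSum _ F (rmk _ g) := by
  classical
  have key : ∀ y : RCoset (levelD0 L n p), toSum _ (frobD L n p) (rmk _ (frobP n p * g * y.out⁻¹))
      = if y = rmk _ g then 1 else 0 := by
    intro y
    rw [frobD, dcoset_apply]
    refine if_congr ⟨?_, ?_⟩ rfl rfl
    · rintro ⟨k, hk, h⟩
      rw [rmk_eq] at h
      rw [← rmk_out _ y, rmk_eq]
      have h2 := inv_mem (mul_mem (inv_mem hk) (conj_frobP_mem L h))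
      convert h2 using 1
      group
    · rintro rfl
      obtain ⟨k, hk, h⟩ := exists_out_eq (K := levelD0 L n p) g
      exact ⟨k⁻¹, inv_mem hk, by rw [h]; congr 1; group⟩
  rw [toSum_mul, convolve_apply]
  simp only [key]
  simp +contextual [Finsupp.sum, eq_comm]

/-- By `frobD_mul_apply` and commutation, F(g) is the coefficient at π g of the product in the other
order. That coefficient is a sum of values F(π g k⁻¹ π⁻¹) over the cosets D_0 π k, so some term is
nonzero. -/
theorem exists_ne_zero_of_commute {F : HeckeAlgebra (levelD0 L n p)}
    (hF : frobD L n p * F = F * frobD L n p) {g : Parab n p} (hg : toSum _ F (rmk _ g) ≠ 0) :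
    ∃ k ∈ levelD0 L n p, toSum _ F (rmk _ (frobP n p * g * k * (frobP n p)⁻¹)) ≠ 0 := by
  classical
  rw [← frobD_mul_apply, hF, toSum_mul, convolve_apply] at hg
  obtain ⟨y, hy, h⟩ := Finset.exists_ne_zero_of_sum_ne_zero hg
  rw [Finsupp.mem_support_iff, frobD, dcoset_apply] at hy
  obtain ⟨k, hk, rfl⟩ : y ∈ cosetsIn (levelD0 L n p) (frobP n p) := by
    by_contra hc
    simp [hc] at hy
  obtain ⟨l, hl, e⟩ := exists_out_eq (K := levelD0 L n p) (frobP n p * k)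
  refine ⟨k⁻¹, inv_mem hk, ?_⟩
  have h2 := right_ne_zero_of_mul h
  rw [e] at h2
  have e2 : frobP n p * g * (l * (frobP n p * k))⁻¹
      = frobP n p * g * k⁻¹ * (frobP n p)⁻¹ * l⁻¹ := by group
  rwa [e2, invariants_apply_mul (toSum_mem _ F) _ (inv_mem hl)] at h2

theorem exists_ne_zero_of_commute_pow {F : HeckeAlgebra (levelD0 L n p)}
    (hF : frobD L n p * F = F * frobD L n p) {g : Parab n p} (hg : toSum _ F (rmk _ g) ≠ 0)
    (j : ℕ) : ∃ k ∈ levelD0 L n p,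
      toSum _ F (rmk _ (frobP n p ^ j * (g * k) * (frobP n p ^ j)⁻¹)) ≠ 0 := by
  induction j with
  | zero => exact ⟨1, one_mem _, by simpa using hg⟩
  | succ j ih =>
    obtain ⟨k, hk, h⟩ := ih
    obtain ⟨l, hl, h'⟩ := exists_ne_zero_of_commute L hF h
    -- Moving l to the left past π^(-j) replaces it by π^(-j) l π^j, which stays in D_0 by
    -- contraction.
    refine ⟨k * ((frobP n p ^ j)⁻¹ * l * frobP n p ^ j),
      mul_mem hk (conj_pow_frobP_mem L hl j), ?_⟩
    convert h' using 3
    rw [pow_succ']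
    group

/-- The support consists of finitely many right cosets, and left multiplication by the integral
matrices of D_0 does not increase the maximal norm of the entries. -/
theorem exists_support_bound (F : HeckeAlgebra (levelD0 L n p)) :
    ∃ C : ℝ, ∀ g, toSum _ F (rmk _ g) ≠ 0 → ∀ i j, ‖blockB g i j‖ ≤ C := by
  have hb : ∀ y : RCoset (levelD0 L n p), ∃ C : ℝ, 1 ≤ C ∧ ∀ i j, ‖y.out.1.1 i j‖ ≤ C :=
    fun y => exists_norm_bound _
  choose C hC1 hC using hb
  refine ⟨∑ y ∈ (toSum _ F).support, C y, fun g hg i j => ?_⟩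
  have hle : C (rmk _ g) ≤ ∑ y ∈ (toSum _ F).support, C y :=
    Finset.single_le_sum (fun y _ => zero_le_one.trans (hC1 y)) (Finsupp.mem_support_iff.2 hg)
  refine le_trans ?_ hle
  obtain ⟨k, hk, e⟩ := exists_out_eq (K := levelD0 L n p) g
  have e2 : g = k⁻¹ * (rmk (levelD0 L n p) g).out := by rw [e]; group
  have h3 := norm_mul_apply_le zero_le_one (zero_le_one.trans (hC1 (rmk _ g)))
    (entries_of_mem L (inv_mem hk)) (hC (rmk _ g)) (Sum.inl i) (Sum.inr j)
  rw [one_mul] at h3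
  have e3 : blockB g i j
      = (k⁻¹.1.1 * (rmk (levelD0 L n p) g).out.1.1) (Sum.inl i) (Sum.inr j) :=
    congrArg (fun h : Parab n p => h.1.1 (Sum.inl i) (Sum.inr j)) e2
  rwa [e3]

/-- The b-block of π^N (g k) π^(-N) is p^(-2N) times that of g k, and the support bound holds for it
uniformly in N. -/
theorem exists_small_blockB_of_commute {F : HeckeAlgebra (levelD0 L n p)}
    (hF : frobD L n p * F = F * frobD L n p) {g : Parab n p} (hg : toSum _ F (rmk _ g) ≠ 0)
    {ε : ℝ} (hε : 0 < ε) : ∃ k ∈ levelD0 L n p, ∀ i j, ‖blockB (g * k) i j‖ ≤ ε := by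
  obtain ⟨C, hC⟩ := exists_support_bound L F
  have hp1 : (p : ℝ)⁻¹ < 1 := inv_lt_one_of_one_lt₀ (by exact_mod_cast (Fact.out : p.Prime).one_lt)
  have hp0 : 0 < (p : ℝ)⁻¹ := inv_pos.2 (by exact_mod_cast (Fact.out : p.Prime).pos)
  -- The support bound C is not known to be positive, hence |C| + 1.
  obtain ⟨N, hN⟩ := exists_pow_lt_of_lt_one (div_pos hε (by positivity : 0 < |C| + 1)) hp1
  obtain ⟨k, hk, h⟩ := exists_ne_zero_of_commute_pow L hF hg N
  refine ⟨k, hk, fun i j => ?_⟩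
  have hb := hC _ h i j
  have e : g * k = (frobP n p ^ N)⁻¹ * (frobP n p ^ N * (g * k) * (frobP n p ^ N)⁻¹)
      * frobP n p ^ N := by group
  rw [e, blockB_conj_inv_pow, Matrix.smul_apply, smul_eq_mul, norm_mul, norm_pow, Padic.norm_p]
  rw [lt_div_iff₀ (by positivity)] at hN
  have h1 : (p : ℝ)⁻¹ ^ (2 * N) ≤ (p : ℝ)⁻¹ ^ N :=
    pow_le_pow_of_le_one hp0.le hp1.le (by omega)
  calc _ ≤ (p : ℝ)⁻¹ ^ N * (|C| + 1) :=
        mul_le_mul h1 (hb.trans ((le_abs_self C).trans (by linarith))) (norm_nonneg _)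
          (by positivity)
    _ ≤ ε := hN.le

theorem norm_b_inv_pos : 0 < ‖((L.b⁻¹ : ℚ) : ℚ_[p])‖ := by
  rw [norm_pos_iff]
  exact_mod_cast (inv_pos.2 L.b_pos).ne'

/-- The elements of the centraliser of the double coset of `π` are supported on the double cosets
of diagonal elements. -/
theorem diagP_inv_mul_mem_of_commute {F : HeckeAlgebra (levelD0 L n p)}
    (hF : frobD L n p * F = F * frobD L n p) {g : Parab n p} (hg : toSum _ F (rmk _ g) ≠ 0) :
    (diagP (dHom g))⁻¹ * g ∈ levelD0 L n p := by
  obtain ⟨C, hC1, hC⟩ := exists_norm_bound g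
  have hb := norm_b_inv_pos (p := p) L
  have hC0 : 0 < C := by linarith
  -- Dividing by C compensates for the later multiplication by dᵀ, whose entries have norm at most
  -- C.
  obtain ⟨k, hk, hk'⟩ := exists_small_blockB_of_commute L hF hg (div_pos hb hC0)
  obtain ⟨k1, k2, -⟩ := (mem_levelD0 L k).1 hk
  have hA : blockA ((diagP (dHom g))⁻¹) = (blockD g)ᵀ := by rw [blockA_inv, blockD_diagP, dHom_coe]
  have hB : blockB ((diagP (dHom g))⁻¹) = 0 := by rw [blockB_inv, blockB_diagP]; simp
  have hD : blockD ((diagP (dHom g))⁻¹) * blockD g = 1 := by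
    rw [diagP_inv, blockD_diagP]
    exact Units.inv_mul (dHom g)
  -- As dᵀ a = 1, the diagonal blocks of this product are those of k, while its b-block is dᵀ times
  -- the small b-block of g k.
  have hmem : (diagP (dHom g))⁻¹ * (g * k) ∈ levelD0 L n p := by
    refine (mem_levelD0 L _).2 ⟨?_, ?_, fun i j => ?_⟩
    · rw [blockA_mul, blockA_mul, ← Matrix.mul_assoc, hA, transpose_blockD_mul_blockA,
        Matrix.one_mul]
      exact k1
    · rw [blockD_mul, blockD_mul, ← Matrix.mul_assoc, hD, Matrix.one_mul]
      exact k2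
    · rw [blockB_mul, hA, hB, Matrix.zero_mul, add_zero]
      have h := norm_mul_apply_le (A := (blockD g)ᵀ) hC0.le (div_pos hb hC0).le
        (fun i j => hC (Sum.inr j) (Sum.inr i)) hk' i j
      rwa [mul_div_cancel₀ _ hC0.ne'] at h
  have h := mul_mem hmem (inv_mem hk)
  rwa [← mul_assoc, mul_inv_cancel_right] at h

theorem apply_eq_apply_diagP_of_commute {F : HeckeAlgebra (levelD0 L n p)}
    (hF : frobD L n p * F = F * frobD L n p) {g : Parab n p} (hg : toSum _ F (rmk _ g) ≠ 0) :
    toSum _ F (rmk _ g) = toSum _ F (rmk _ (diagP (dHom g))) := by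
  rw [← invariants_apply_mul (toSum_mem _ F) (diagP (dHom g))
    (diagP_inv_mul_mem_of_commute L hF hg), mul_inv_cancel_left]

/-- For unipotent u in D_0 with b-block x, the element u diag[r̃, r] lies in the same right coset
and has the same d. Hence diag[r̃, r]⁻¹ u diag[r̃, r] is in D_0, which says that rᵀ x r has entries
in 𝔟⁻¹. -/
theorem norm_le_one_of_commute {F : HeckeAlgebra (levelD0 L n p)}
    (hF : frobD L n p * F = F * frobD L n p) {r : GL (Fin n) ℚ_[p]}
    (hr : toSum _ F (rmk _ (diagP r)) ≠ 0) (i j : Fin n) : ‖r.1 i j‖ ≤ 1 := by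
  -- With this x the (j, j) entry of rᵀ x r is r_ij² times the generator of 𝔟⁻¹, which isolates one
  -- entry of r.
  set x : Matrix (Fin n) (Fin n) ℚ_[p] := Matrix.single i i ((L.b⁻¹ : ℚ) : ℚ_[p]) with hx
  have hxt : xᵀ = x := by rw [hx, Matrix.transpose_single]
  have hu : unip x hxt ∈ levelD0 L n p := by
    have h1 : ∀ a b : Fin n, ‖(1 : Matrix (Fin n) (Fin n) ℚ_[p]) a b‖ ≤ 1 := by
      intro a b
      by_cases h : a = b <;> simp [Matrix.one_apply, h]
    refine (mem_levelD0 L _).2 ⟨h1, h1, fun a b => ?_⟩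
    rw [blockB_unip, hx, Matrix.single_apply]
    split_ifs
    · exact le_rfl
    · rw [norm_zero]; exact norm_nonneg _
  have hd : dHom (unip x hxt * diagP r) = r := by
    apply Units.ext
    rw [dHom_coe, blockD_mul, blockD_unip, blockD_diagP, Matrix.one_mul]
  have h := diagP_inv_mul_mem_of_commute L hF (g := unip x hxt * diagP r)
    (by rwa [rmk_mul_left _ hu])
  rw [hd] at h
  have h2 := ((mem_levelD0 L _).1 h).2.2 j j
  have e : blockB ((diagP r)⁻¹ * (unip x hxt * diagP r)) j j
      = r.1 i j ^ 2 * ((L.b⁻¹ : ℚ) : ℚ_[p]) := by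
    rw [blockB_mul, blockB_mul, blockB_inv, blockB_diagP, blockB_unip, blockD_diagP, blockA_inv,
      blockD_diagP]
    simp [hx, Matrix.mul_apply, Matrix.single_apply, ite_and]
    ring
  rw [e, norm_mul, norm_pow] at h2
  have h3 : ‖r.1 i j‖ ^ 2 ≤ 1 :=
    le_of_mul_le_mul_right (by simpa using h2) (norm_b_inv_pos (p := p) L)
  exact (sq_le_one_iff₀ (norm_nonneg _)).1 h3

/-- All cosets of the support over one coset GL_n(ℤ_p) d carry the same coefficient c, namely the
value at diag[d̃, d]. The coefficient of the image is therefore c times the number of these cosets,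
which is nonzero in characteristic 0. -/
theorem eq_zero_of_commute_of_dPush_eq_zero {F : HeckeAlgebra (levelD0 L n p)}
    (hF : frobD L n p * F = F * frobD L n p) (h0 : dPush L n p F = 0) : F = 0 := by
  classical
  by_contra hne
  have hne' : toSum _ F ≠ 0 := fun h => hne (toSum_injective _ (h.trans (map_zero _).symm))
  obtain ⟨y, hy⟩ := Finsupp.ne_iff.1 hne'
  rw [← rmk_out _ y] at hy
  set g := y.out
  set c := toSum _ F (rmk _ g) with hc
  have hval : ∀ h, toSum _ F (rmk _ h) ≠ 0 →
      rmk (integralGL n p) (dHom h) = rmk (integralGL n p) (dHom g) → toSum _ F (rmk _ h) = c := by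
    intro h hh he
    rw [hc, apply_eq_apply_diagP_of_commute L hF hh, apply_eq_apply_diagP_of_commute L hF hy]
    rw [rmk_eq] at he
    congr 1
    -- Changing d by GL_n(ℤ_p) on the left changes the diagonal element by an element of D_0 on the
    -- left.
    rw [rmk_eq, diagP_inv, ← diagP_mul]
    exact diagP_mem L he
  have h1 := congrArg (fun A => toSum _ A (rmk _ (dHom g))) h0
  have h2 : (toSum (integralGL n p) (dPush L n p F)) (rmk _ (dHom g))
      = ∑ y ∈ (toSum _ F).support,
        if rmk (integralGL n p) (dHom y.out) = rmk _ (dHom g) then c else 0 := by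
    rw [dPush, toSum_push]
    conv_lhs => rw [← Finsupp.sum_single (toSum _ F), Finsupp.sum, map_sum,
      Finsupp.finsetSum_apply]
    refine Finset.sum_congr rfl fun y hy => ?_
    rw [Finsupp.mem_support_iff, ← rmk_out _ y] at hy
    conv_lhs => rw [← rmk_out _ y, pushSum_single]
    rw [Finsupp.smul_apply, Finsupp.single_apply]
    split_ifs with he
    · rw [hval _ hy he]; simp
    · simp
  simp only [map_zero, Finsupp.coe_zero, Pi.zero_apply] at h1
  rw [h2, ← Finset.sum_filter, Finset.sum_const, nsmul_eq_mul] at h1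
  rcases mul_eq_zero.1 h1 with h3 | h3
  · rw [Nat.cast_eq_zero, Finset.card_eq_zero] at h3
    have hmem : y ∈ (toSum _ F).support.filter
        (fun y => rmk (integralGL n p) (dHom y.out) = rmk _ (dHom g)) :=
      Finset.mem_filter.2 ⟨Finsupp.mem_support_iff.2 (by rw [← rmk_out _ y]; exact hy), rfl⟩
    rw [h3] at hmem
    exact absurd hmem (Finset.notMem_empty _)
  · exact hy h3

theorem proj_commute {A : S0 L n p} (hA : A ∈ centraliserU L n p) :
    frobD L n p * proj L n p A = proj L n p A * frobD L n p := by
  have h : frobU L n p * A = A * frobU L n p :=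
    (Subalgebra.mem_centralizer_iff ℂ).1 hA _ (Set.mem_singleton _)
  have h2 := congrArg (proj L n p) h
  rwa [map_mul, map_mul, frobU, proj_cosetA] at h2

end Metaplectic

/-- The centraliser of `U_p` in `𝒮_{0p}` is contained in the span of the double cosets `A_r` with
`r ∈ M_n(ℤ_p) ∩ GL_n(ℚ_p)`, and `Φ_p'` is injective on it. -/
theorem mainTheorem4 (n p : ℕ) [Fact p.Prime] (L : Metaplectic.Level) (hp : ¬ p ∣ L.c) :
    (∀ A ∈ Metaplectic.centraliserU L n p,
      A ∈ Submodule.span ℂ {B : Metaplectic.S0 L n p | ∃ r : Matrix.GeneralLinearGroup (Fin n) ℚ_[p],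
        (∀ i j, ‖r.1 i j‖ ≤ 1) ∧ B = Metaplectic.cosetA L r}) ∧
    Set.InjOn (Metaplectic.phi L n p) (Metaplectic.centraliserU L n p) := by
  open Metaplectic HeckeAlg in
  constructor
  · intro A hA
    have hF := proj_commute L hA
    have h1 : proj L n p A ∈ Submodule.span ℂ (dcoset (isHeckePair_levelD0 L n p) ''
        {g | ∃ r : GL (Fin n) ℚ_[p], (∀ i j, ‖r.1 i j‖ ≤ 1) ∧ g = diagP r}) := by
      refine mem_span_dcoset _ _ _ fun y hy => ?_
      rw [← rmk_out _ y] at hy ⊢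
      refine ⟨diagP (dHom y.out), ⟨_, norm_le_one_of_commute L hF ?_, rfl⟩, _,
        diagP_inv_mul_mem_of_commute L hF hy, ?_⟩
      · rwa [← apply_eq_apply_diagP_of_commute L hF hy]
      · rw [mul_inv_cancel_left]
    -- These double cosets are the images of the A_r, so injectivity of `proj` brings the linear
    -- combination back to 𝒮_{0p}.
    have h2 : proj L n p A ∈ Submodule.map (proj L n p).toLinearMap
        (Submodule.span ℂ {B : S0 L n p | ∃ r : GL (Fin n) ℚ_[p],
          (∀ i j, ‖r.1 i j‖ ≤ 1) ∧ B = cosetA L r}) := by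
      refine Submodule.span_le.2 ?_ h1
      rintro _ ⟨_, ⟨r, hr, rfl⟩, rfl⟩
      exact ⟨cosetA L r, Submodule.subset_span ⟨r, hr, rfl⟩, proj_cosetA L r⟩
    obtain ⟨B, hB, e⟩ := h2
    rwa [← proj_injective L e]
  · intro A hA B hB h
    -- The centraliser is a linear subspace, so injectivity reduces to the vanishing of A - B.
    have hE := proj_commute L ((centraliserU L n p).sub_mem hA hB)
    rw [← sub_eq_zero]
    apply proj_injective L
    rw [map_zero]
    refine eq_zero_of_commute_of_dPush_eq_zero L hE ?_
    rw [dPush_proj, map_sub, h, sub_self]
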